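/- Let $n\ge 0$ be an integer, let $q>1$ be a prime power, and let $G=\mathbf{U}_{n+1}(\mathbb{F}_q)$ be the group of $(n+1)\times(n+1)$ upper triangular matrices over $\mathbb{F}_q$ with all diagonal entries equal to $1$. Let $\mathfrak{n}$ be the space of strictly upper triangular $(n+1)\times(n+1)$ matrices over $\mathbb{F}_q$, and fix a nontrivial homomorphism $\theta:\mathbb{F}_q^+\to\mathbb{C}^\times$. The supercharacters of $G$ are the characters of the left $G$-modules $\mathbb{C}G\,v_\lambda$, where $\lambda:\mathfrak{n}\to\mathbb{F}_q$ is linear and $v_\lambda=\sum_{g\in G}\theta(\lambda(g-1))\,g\in\mathbb{C}G$. A character $\chi$ of $G$ is Heisenberg if it is irreducible and its kernel $\{g\in G:\chi(g)=\chi(1)\}$ contains $[G,[G,G]]$. Let $C$ be the group of linear characters $\vartheta\circ\sigma$ of $G$, where $\vartheta$ runs over $\mathrm{Hom}(\mathbb{F}_q^+,\mathbb{C}^\times)$ and $\sigma(g)=\sum_{i=1}^{n}g_{i,i+1}$; a function $\chi$ on $G$ is $C$-invariant if $\psi\chi=\chi$ for all $\psi\in C$. For a set partition of $[m]=\{1,\dots,m\}$,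 an arc is a pair $(i,j)$ with $i<j$ such that $i$ and $j$ are consecutive elements of a block, and the partition is noncrossing if it has no two arcs $(i,k),(j,l)$ with $i<j<k<l$. Let $N(m,k)$ be the number of noncrossing set partitions of $[m]$ with $k$ blocks, and let $D(a,b)$ be the number of lattice paths from $(0,0)$ to $(a,b)$ with steps in $\{(1,0),(1,1),(0,1)\}$. Put $$\mathrm{Cat}_{m}(x)=\sum_{k=0}^{m}N(m,k)\,x^{m-k},\qquad \mathrm{Pell}_{n+1}(x)=\sum_{k=0}^{n}D(n-k,k)\,x^{k},\qquad \mathcal{C}_m=\frac{1}{m+1}\binom{2m}{m}.$$ Then: (1) The number of $C$-invariant irreducible supercharacters of $\mathbf{U}_{n+1}(\mathbb{F}_q)$ is $$(1-q)^{\lfloor n/2\rfloor}\,\mathrm{Cat}_{n+1}(-1)=\begin{cases}(q-1)^{n/2}\,\mathcal{C}_{n/2},&\text{if } n \text{ is even},\\ 0,&\text{if } n\text{ is odd}.\end{cases}$$ (2) The number of $C$-invariant Heisenberg supercharacters of $\mathbf{U}_{n+1}(\mathbb{F}_q)$ is $$(1-q)^{\lfloor n/2\rfloor}\,\mathrm{Pell}_{n+1}(-1)=\begin{cases}(q-1)^{n/2},&\text{if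 } n \text{ is even},\\ 0,&\text{if } n\text{ is odd}.\end{cases}$$ -/

import Mathlib

/-- The submodule `𝔲_N(F)` of strictly upper triangular `N × N` matrices. -/
def strictUpper (N : ℕ) (F : Type*) [Field F] : Submodule F (Matrix (Fin N) (Fin N) F) where
  carrier := {X | ∀ i j, j ≤ i → X i j = 0}
  add_mem' {X Y} hX hY i j h := by simp [hX i j h, hY i j h]
  zero_mem' _ _ _ := rfl
  smul_mem' c X hX i j h := by simp [hX i j h]

/-- The unitriangular group `U_N(F)`: invertible matrices that are upper triangular with
all diagonal entries equal to `1`. -/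
def unitriangular (N : ℕ) (F : Type*) [Field F] : Subgroup (Matrix (Fin N) (Fin N) F)ˣ where
  carrier := {g | (∀ i j, j < i → g.val i j = 0) ∧ ∀ i, g.val i i = 1}
  one_mem' := ⟨fun i j h => Matrix.one_apply_ne h.ne', fun i => Matrix.one_apply_eq i⟩
  mul_mem' {g h} hg hh := by
    refine ⟨fun i j hij => ?_, fun i => ?_⟩
    · rw [Units.val_mul, Matrix.mul_apply]
      refine Finset.sum_eq_zero fun k _ => ?_
      rcases lt_or_ge k i with hk | hk
      · rw [hg.1 i k hk, zero_mul]
      · rw [hh.1 k j (hij.trans_le hk), mul_zero]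
    · rw [Units.val_mul, Matrix.mul_apply, Finset.sum_eq_single i]
      · rw [hg.2, hh.2, one_mul]
      · intro k _ hki
        rcases lt_or_gt_of_ne hki with hk | hk
        · rw [hg.1 i k hk, zero_mul]
        · rw [hh.1 k i hk, mul_zero]
      · simp
  inv_mem' {g} hg := by
    have hT : Matrix.BlockTriangular g.val id := fun i j h => hg.1 i j h
    have : Invertible g.val := g.isUnit.invertible
    have hI : ∀ i j, j < i → (g⁻¹).val i j = 0 := by
      intro i j h
      rw [Matrix.coe_units_inv]
      exact Matrix.blockTriangular_inv_of_blockTriangular hT h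
    refine ⟨hI, fun i => ?_⟩
    have h1 : (g.val * (g⁻¹).val) i i = 1 := by rw [Units.mul_inv, Matrix.one_apply_eq]
    rw [Matrix.mul_apply, Finset.sum_eq_single i] at h1
    · rwa [hg.2, one_mul] at h1
    · intro k _ hki
      rcases lt_or_gt_of_ne hki with hk | hk
      · rw [hg.1 i k hk, zero_mul]
      · rw [hI k i hk, mul_zero]
    · simp

/-- The element `g - 1` of `𝔲_N(F)`, for `g` in `U_N(F)`. -/
def unitriangularSubOne {N : ℕ} {F : Type*} [Field F] (g : unitriangular N F) :
    strictUpper N F :=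
  ⟨(g : (Matrix (Fin N) (Fin N) F)ˣ).val - 1, fun i j h => by
    rcases h.lt_or_eq with h | rfl
    · rw [Matrix.sub_apply, g.2.1 i j h, Matrix.one_apply_ne h.ne', sub_zero]
    · rw [Matrix.sub_apply, g.2.2 j, Matrix.one_apply_eq, sub_self]⟩

/-- The element `v_λ = ∑_{g} θ(λ(g - 1)) g` of the complex group algebra of `U_N(F)`. -/
noncomputable def superVector {N : ℕ} {F : Type*} [Field F] [Finite F]
    (θ : AddChar F ℂ) (l : Module.Dual F (strictUpper N F)) :
    MonoidAlgebra ℂ (unitriangular N F) :=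
  ∑ᶠ g : unitriangular N F, MonoidAlgebra.single g (θ (l (unitriangularSubOne g)))

/-- The left submodule `ℂG v_λ` of `ℂG`, where `G = U_N(F)`. -/
noncomputable def superModule {N : ℕ} {F : Type*} [Field F] [Finite F]
    (θ : AddChar F ℂ) (l : Module.Dual F (strictUpper N F)) :
    Submodule (MonoidAlgebra ℂ (unitriangular N F)) (MonoidAlgebra ℂ (unitriangular N F)) :=
  Submodule.span (MonoidAlgebra ℂ (unitriangular N F)) {superVector θ l}

/-- `χ` is a supercharacter of `G = U_N(F)`: the character of a left `G`-module `ℂG v_λ`. -/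
def IsSupercharacter {N : ℕ} {F : Type*} [Field F] [Finite F]
    (θ : AddChar F ℂ) (χ : unitriangular N F → ℂ) : Prop :=
  ∃ l : Module.Dual F (strictUpper N F),
    χ = (Representation.ofModule' (k := ℂ) (G := unitriangular N F) (superModule θ l)).character

/-- `χ` is the character of an irreducible finite-dimensional complex representation of `G`. -/
def IsIrreducibleCharacter {G : Type*} [Group G] (χ : G → ℂ) : Prop :=
  ∃ (d : ℕ) (ρ : Representation ℂ G (Fin d → ℂ)), ρ.IsIrreducible ∧ χ = ρ.character

/-- `χ` is a Heisenberg character of `G`: it is irreducible and its kernel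
`{g | χ g = χ 1}` contains `[G, [G, G]]`. -/
def IsHeisenbergCharacter {G : Type*} [Group G] (χ : G → ℂ) : Prop :=
  IsIrreducibleCharacter χ ∧
    ∀ g ∈ ⁅(⊤ : Subgroup G), ⁅(⊤ : Subgroup G), (⊤ : Subgroup G)⁆⁆, χ g = χ 1

/-- `σ(g)`, the sum of the entries of `g` on the first superdiagonal. -/
def superdiagSum {n : ℕ} {F : Type*} [Field F] (g : unitriangular (n + 1) F) : F :=
  ∑ i : Fin n, (g : (Matrix (Fin (n + 1)) (Fin (n + 1)) F)ˣ).val i.castSucc i.succ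

/-- The set `C` of linear characters `ϑ ∘ σ` of `U_{n+1}(F)`, where `ϑ` runs over the
homomorphisms from the additive group of `F` to the multiplicative group of `ℂ`. -/
def superdiagCharacters (n : ℕ) (F : Type*) [Field F] : Set (unitriangular (n + 1) F → ℂ) :=
  {ψ | ∃ ϑ : AddChar F ℂ, ∀ g, ψ g = ϑ (superdiagSum g)}

/-- `χ` is unchanged by multiplication by every element of `C`. -/
def IsCInvariant {n : ℕ} {F : Type*} [Field F] (χ : unitriangular (n + 1) F → ℂ) : Prop :=
  ∀ ψ ∈ superdiagCharacters n F, ψ * χ = χ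

/-- `(i, j)` is an arc of the set partition `P`: `i < j` are consecutive elements of a block. -/
def IsArc {n : ℕ} (P : Finpartition (Finset.univ : Finset (Fin n))) (i j : Fin n) : Prop :=
  i < j ∧ ∃ B ∈ P.parts, i ∈ B ∧ j ∈ B ∧ ∀ k ∈ B, ¬ (i < k ∧ k < j)

/-- No two arcs `(i, k)`, `(j, l)` satisfy `i < j < k < l`. -/
def IsNoncrossing {n : ℕ} (P : Finpartition (Finset.univ : Finset (Fin n))) : Prop :=
  ∀ i j k l, IsArc P i k → IsArc P j l → ¬ (i < j ∧ j < k ∧ k < l)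

/-- The Narayana number: the number of noncrossing partitions of an `n`-element chain with
`k` blocks. -/
noncomputable def narayanaNumber (n k : ℕ) : ℕ :=
  Nat.card {P : Finpartition (Finset.univ : Finset (Fin n)) //
    IsNoncrossing P ∧ P.parts.card = k}

/-- The Narayana polynomial `∑_{k=0}^{n} N(n, k) x^{n-k}`. -/
noncomputable def narayanaPolynomial (n : ℕ) : Polynomial ℤ :=
  ∑ k ∈ Finset.range (n + 1), Polynomial.C (narayanaNumber n k : ℤ) * Polynomial.X ^ (n - k)

/-- The Delannoy number: the number of lattice paths from `(0, 0)` to `(a, b)` with steps in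
`{(1, 0), (1, 1), (0, 1)}`. -/
noncomputable def delannoyNumber (a b : ℕ) : ℕ :=
  Set.ncard {P : List (ℕ × ℕ) |
    (∀ s ∈ P, s = (1, 0) ∨ s = (1, 1) ∨ s = (0, 1)) ∧ P.sum = (a, b)}

/-- The polynomial `∑_{k=0}^{n} D(n-k, k) x^k`, whose value at `1` is a Pell number. -/
noncomputable def pellPolynomialSucc (n : ℕ) : Polynomial ℤ :=
  ∑ k ∈ Finset.range (n + 1), Polynomial.C (delannoyNumber (n - k) k : ℤ) * Polynomial.X ^ k

/-! The module `ℂG v_λ` is monomial: group elements permute the vectors `v_μ`, for `μ` in the left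
orbit of `λ`, up to scalars. Its trace can be symmetrised into a multiple of the sum of `θ(-λ(g X
h))` over all pairs `(g, h)` (`leftStabCard_mul_superCharacter`). Fourier analysis on the additive
group `𝔫` then identifies supercharacters with two-sided orbits of functionals
(`superCharacter_eq_iff`) and turns norms of characters into orders of stabilizers.

Write functionals as strictly upper triangular matrices. Translations become downward row operations
and leftward column operations, and each orbit has exactly one matrix with at most one nonzero entry
in each row and column (`exists_isQuasiMonomial_sameOrbit`, `IsQuasiMonomial.eq_of_sameOrbit`): a
set partition whose arcs are labelled by nonzero scalars. Irreducible means noncrossing, and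
Heisenberg means moreover that all arcs have length at most 2. Multiplication by a character in `C`
translates the orbit by a multiple of `σ`; a noncrossing orbit is stable under this exactly when,
for every `k`, an arc of length at least 2 starts at `k` or ends at `k + 1`.

For the count, an arc `(a, k)` leaving the least point splits a noncrossing arc set on `[a, b)` into
one on `[a + 1, k)` and one on `[k, b)` (`sum_arcSets`). The covering condition forces such an arc,
with `k > a + 1`. With weight `y = q - 1` per arc this is the Catalan recurrence, with the Catalan
numbers sitting at odd interval lengths; if arcs have length at most 2, then `k = a + 2` and a
single power of `y` remains. In `Cat(-1)`, arc sets with no arc at `a` cancel those with `k = a +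
1`, so the same recurrence holds with `y = -1`, and `(1 - q)(-1) = q - 1` matches the two. Finally,
the Delannoy generating function `1 / (1 - x - y - xy)` at `y = -x` is `1 / (1 + x²)`, which
evaluates the Pell side. -/

open Finset

/-! ### Irreducibility through the norm of a character -/

section Irreducibility

variable {G V : Type*} [Group G] [Fintype G] [AddCommGroup V] [Module ℂ V]

/-- A converse of Schur's lemma: the projection onto a subrepresentation is an endomorphism, hence a
scalar, so its image is zero or everything. -/
theorem Representation.isIrreducible_of_finrank_intertwiningMap_eq_one
    (ρ : Representation ℂ G V)
    (h : Module.finrank ℂ (Representation.IntertwiningMap ρ ρ) = 1) : ρ.IsIrreducible := by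
  rw [Representation.irreducible_iff_isSimpleModule_asModule]
  have hcard : NeZero (Nat.card G : ℂ) := ⟨by exact_mod_cast Nat.card_pos.ne'⟩
  have hscal : ∀ f : Module.End (MonoidAlgebra ℂ G) ρ.asModule,
      ∃ c : ℂ, ∀ x : ρ.asModule, f x = c • x := by
    intro f
    obtain ⟨v, hv⟩ := (finrank_eq_one_iff_of_nonzero' (1 : Representation.IntertwiningMap ρ ρ)
      (by
        intro h0
        have : Subsingleton (Representation.IntertwiningMap ρ ρ) :=
          ⟨fun a b => by rw [← one_mul a, ← one_mul b, h0, zero_mul, zero_mul]⟩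
        rw [Module.finrank_zero_of_subsingleton] at h
        exact zero_ne_one h)).1 h
      ((Representation.IntertwiningMap.equivLinearMapAsModule ρ ρ).symm f)
    refine ⟨v, fun x => ?_⟩
    have := congrArg (Representation.IntertwiningMap.equivLinearMapAsModule ρ ρ) hv
    rw [LinearEquiv.apply_symm_apply] at this
    rw [← this]
    rfl
  have hnt : Nontrivial ρ.asModule := by
    by_contra hsub
    rw [not_nontrivial_iff_subsingleton] at hsub
    have : Subsingleton (Representation.IntertwiningMap ρ ρ) :=
      (Representation.IntertwiningMap.equivLinearMapAsModule ρ ρ).toEquiv.subsingleton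
    rw [Module.finrank_zero_of_subsingleton] at h
    exact zero_ne_one h
  rw [isSimpleModule_iff]
  refine { eq_bot_or_eq_top := fun W => ?_ }
  -- The complement comes from Maschke's theorem, which needs the order of `G` to be invertible
  -- (`hcard`).
  obtain ⟨W', hW⟩ := exists_isCompl W
  obtain ⟨c, hc⟩ := hscal (W.subtype ∘ₗ W.projectionOnto W' hW)
  rcases eq_or_ne c 0 with rfl | hc0
  · left
    rw [Submodule.eq_bot_iff]
    intro x hx
    have := hc x
    rw [zero_smul] at this
    rw [← this]
    exact (congrArg Subtype.val (Submodule.projectionOnto_apply_left hW ⟨x, hx⟩)).symm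
  · right
    rw [Submodule.eq_top_iff']
    intro x
    have : c⁻¹ • c • x ∈ W.restrictScalars ℂ := by
      rw [← hc x]
      exact Submodule.smul_mem _ _ (Submodule.projectionOnto W W' hW x).2
    rwa [inv_smul_smul₀ hc0] at this

theorem isIrreducibleCharacter_iff_norm_eq_one [FiniteDimensional ℂ V] (ρ : Representation ℂ G V) :
    IsIrreducibleCharacter ρ.character ↔
      ∑ g : G, ρ.character g * ρ.character g⁻¹ = Nat.card G := by
  have hG : (Nat.card G : ℂ) ≠ 0 := by exact_mod_cast Nat.card_pos.ne'
  let _ : Invertible (Nat.card G : ℂ) := invertibleOfNonzero hG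
  constructor
  · rintro ⟨d, τ, hτ, h⟩
    rw [h]
    have h1 := Representation.card_inv_mul_sum_char_mul_char_eq_finrank τ τ
    rw [Representation.IsIrreducible.finrank_intertwiningMap_self τ, Nat.cast_one,
      inv_mul_eq_one₀ hG] at h1
    exact h1.symm
  · intro h
    -- `IsIrreducibleCharacter` asks for a representation on some `Fin d → ℂ`, so `ρ` is transported
    -- along a basis.
    let e : V ≃ₗ[ℂ] (Fin (Module.finrank ℂ V) → ℂ) := (Module.finBasis ℂ V).equivFun
    let τ : Representation ℂ G (Fin (Module.finrank ℂ V) → ℂ) :=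
      (e.conjRingEquiv : Module.End ℂ V →* _).comp ρ
    have hχ : ρ.character = τ.character := by
      ext g
      exact (LinearMap.trace_conj' (ρ g) e).symm
    refine ⟨_, τ, ?_, hχ⟩
    apply Representation.isIrreducible_of_finrank_intertwiningMap_eq_one
    have h1 := Representation.card_inv_mul_sum_char_mul_char_eq_finrank τ τ
    rw [← hχ, h, inv_mul_cancel₀ hG] at h1
    exact_mod_cast h1.symm

end Irreducibility

/-! ### Two-sided translations of functionals -/

section Sandwich

variable {N : ℕ} {F : Type*} [Field F]

theorem unitriangularSubOne_bijective :
    Function.Bijective (unitriangularSubOne : unitriangular N F → strictUpper N F) := by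
  constructor
  · intro g h hgh
    have := congrArg Subtype.val hgh
    exact Subtype.ext (Units.ext (sub_left_injective this))
  · rintro ⟨X, hX⟩
    have hdiag : ∀ i, (1 + X) i i = 1 := fun i => by
      rw [Matrix.add_apply, hX i i le_rfl, Matrix.one_apply_eq, add_zero]
    have hlow : ∀ i j, j < i → (1 + X) i j = 0 := fun i j h => by
      rw [Matrix.add_apply, hX i j h.le, Matrix.one_apply_ne h.ne', add_zero]
    have hdet : (1 + X).det = 1 := by
      rw [Matrix.det_of_isUpperTriangular (fun i j h => hlow i j h)]
      exact Finset.prod_eq_one fun i _ => hdiag i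
    have hu : IsUnit (1 + X) := (Matrix.isUnit_iff_isUnit_det _).2 (by rw [hdet]; exact isUnit_one)
    refine ⟨⟨hu.unit, hlow, hdiag⟩, Subtype.ext ?_⟩
    exact add_sub_cancel_left 1 X

/-- The bijection `g ↦ g - 1` from `U_N(F)` to `𝔲_N(F)`. -/
noncomputable def unitriangularEquiv : unitriangular N F ≃ strictUpper N F :=
  Equiv.ofBijective _ unitriangularSubOne_bijective

@[simp] theorem unitriangularEquiv_apply (g : unitriangular N F) :
    unitriangularEquiv g = unitriangularSubOne g := rfl

@[simp] theorem coe_unitriangularSubOne (g : unitriangular N F) :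
    (unitriangularSubOne g : Matrix (Fin N) (Fin N) F) = g.1.1 - 1 := rfl

theorem upper_mul_strictUpper {A X : Matrix (Fin N) (Fin N) F} (hA : ∀ i j, j < i → A i j = 0)
    (hX : X ∈ strictUpper N F) : A * X ∈ strictUpper N F := by
  intro i j hij
  rw [Matrix.mul_apply]
  refine Finset.sum_eq_zero fun k _ => ?_
  rcases lt_or_ge k i with hk | hk
  · rw [hA i k hk, zero_mul]
  · rw [hX k j (hij.trans hk), mul_zero]

theorem strictUpper_mul_upper {A X : Matrix (Fin N) (Fin N) F} (hA : ∀ i j, j < i → A i j = 0)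
    (hX : X ∈ strictUpper N F) : X * A ∈ strictUpper N F := by
  intro i j hij
  rw [Matrix.mul_apply]
  refine Finset.sum_eq_zero fun k _ => ?_
  rcases lt_or_ge j k with hk | hk
  · rw [hA k j hk, mul_zero]
  · rw [hX i k (hk.trans hij), zero_mul]

/-- The linear map `X ↦ g X h` of `𝔲_N(F)`. -/
def sandwich (g h : unitriangular N F) : strictUpper N F →ₗ[F] strictUpper N F where
  toFun X := ⟨g.1.1 * X.1 * h.1.1,
    strictUpper_mul_upper h.2.1 (upper_mul_strictUpper g.2.1 X.2)⟩
  map_add' X Y := Subtype.ext (by simp [mul_add, add_mul])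
  map_smul' c X := Subtype.ext (by simp)

@[simp] theorem coe_sandwich (g h : unitriangular N F) (X : strictUpper N F) :
    (sandwich g h X : Matrix (Fin N) (Fin N) F) = g.1.1 * X.1 * h.1.1 := rfl

/-- The product of `𝔲_N(F)`. -/
def strictMul (X Y : strictUpper N F) : strictUpper N F :=
  ⟨X.1 * Y.1, upper_mul_strictUpper (fun i j h => X.2 i j h.le) Y.2⟩

@[simp] theorem coe_strictMul (X Y : strictUpper N F) :
    (strictMul X Y : Matrix (Fin N) (Fin N) F) = X.1 * Y.1 := rfl

theorem strictMul_add (X Y Z : strictUpper N F) :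
    strictMul X (Y + Z) = strictMul X Y + strictMul X Z := Subtype.ext (mul_add _ _ _)

theorem add_strictMul (X Y Z : strictUpper N F) :
    strictMul (X + Y) Z = strictMul X Z + strictMul Y Z := Subtype.ext (add_mul _ _ _)

theorem sandwich_sandwich (g h g' h' : unitriangular N F) (X : strictUpper N F) :
    sandwich g h (sandwich g' h' X) = sandwich (g * g') (h' * h) X := by
  apply Subtype.ext
  simp [mul_assoc]

theorem sandwich_one_one (X : strictUpper N F) :
    sandwich (1 : unitriangular N F) 1 X = X := by
  apply Subtype.ext
  simp

theorem sandwich_left (g : unitriangular N F) (X : strictUpper N F) :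
    sandwich g 1 X = X + strictMul (unitriangularSubOne g) X := by
  apply Subtype.ext
  simp [sub_mul]

theorem sandwich_right (g : unitriangular N F) (X : strictUpper N F) :
    sandwich 1 g X = X + strictMul X (unitriangularSubOne g) := by
  apply Subtype.ext
  simp [mul_sub]

/-- The functional `X ↦ l (g X h)`. -/
def dualTranslate (g h : unitriangular N F) (l : Module.Dual F (strictUpper N F)) :
    Module.Dual F (strictUpper N F) := l ∘ₗ sandwich g h

@[simp] theorem dualTranslate_apply (g h : unitriangular N F) (l : Module.Dual F (strictUpper N F))
    (X : strictUpper N F) : dualTranslate g h l X = l (sandwich g h X) := rfl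

/-- Precomposition reverses composition, so the left factors multiply in the opposite order to the
right factors. -/
theorem dualTranslate_dualTranslate (g h g' h' : unitriangular N F)
    (l : Module.Dual F (strictUpper N F)) :
    dualTranslate g h (dualTranslate g' h' l) = dualTranslate (g' * g) (h * h') l := by
  ext X
  simp [sandwich_sandwich]

@[simp] theorem dualTranslate_one_one (l : Module.Dual F (strictUpper N F)) :
    dualTranslate 1 1 l = l := by
  ext X
  simp [sandwich_one_one]

theorem dualTranslate_inv_dualTranslate (g h : unitriangular N F) (l : Module.Dual F (strictUpper N F)) :
    dualTranslate g⁻¹ h⁻¹ (dualTranslate g h l) = l := by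
  rw [dualTranslate_dualTranslate, mul_inv_cancel, inv_mul_cancel, dualTranslate_one_one]

theorem dualTranslate_injective (g h : unitriangular N F) :
    Function.Injective (dualTranslate (N := N) (F := F) g h) :=
  Function.LeftInverse.injective (dualTranslate_inv_dualTranslate g h)

/-- Two functionals are in the same two-sided orbit. -/
def SameOrbit (l m : Module.Dual F (strictUpper N F)) : Prop :=
  ∃ g h : unitriangular N F, dualTranslate g h l = m

theorem SameOrbit.refl (l : Module.Dual F (strictUpper N F)) : SameOrbit l l :=
  ⟨1, 1, dualTranslate_one_one l⟩

theorem SameOrbit.symm {l m : Module.Dual F (strictUpper N F)} (h : SameOrbit l m) :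
    SameOrbit m l := by
  obtain ⟨a, b, rfl⟩ := h
  exact ⟨a⁻¹, b⁻¹, dualTranslate_inv_dualTranslate a b l⟩

theorem SameOrbit.trans {l m p : Module.Dual F (strictUpper N F)} (h : SameOrbit l m)
    (h' : SameOrbit m p) : SameOrbit l p := by
  obtain ⟨a, b, rfl⟩ := h
  obtain ⟨c, d, rfl⟩ := h'
  exact ⟨a * c, d * b, (dualTranslate_dualTranslate _ _ _ _ _).symm⟩

end Sandwich

/-! ### Additive characters of the strictly upper triangular matrices -/

section Character

variable {N : ℕ} {F : Type*} [Field F]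

/-- The additive character `X ↦ θ (l X)` of `𝔲_N(F)`. -/
def dualChar (θ : AddChar F ℂ) (l : Module.Dual F (strictUpper N F)) :
    AddChar (strictUpper N F) ℂ := θ.compAddMonoidHom l.toAddMonoidHom

@[simp] theorem dualChar_apply (θ : AddChar F ℂ) (l : Module.Dual F (strictUpper N F))
    (X : strictUpper N F) : dualChar θ l X = θ (l X) := rfl

theorem exists_apply_mul_ne_one {θ : AddChar F ℂ} (hθ : θ ≠ 1) {a : F} (ha : a ≠ 0) :
    ∃ c, θ (c * a) ≠ 1 := by
  obtain ⟨x, hx⟩ := AddChar.ne_one_iff.1 hθ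
  exact ⟨x * a⁻¹, by rwa [inv_mul_cancel_right₀ ha]⟩


/-- A functional that is nonzero at `X` takes every value on the line through `X`, including one
where `θ` is not 1. -/
theorem dualChar_eq_zero_iff {θ : AddChar F ℂ} (hθ : θ ≠ 1)
    (l : Module.Dual F (strictUpper N F)) : dualChar θ l = 0 ↔ l = 0 := by
  constructor
  · intro h
    ext X
    by_contra hX
    obtain ⟨c, hc⟩ := exists_apply_mul_ne_one hθ hX
    apply hc
    have := DFunLike.congr_fun h (c • X)
    simpa using this
  · rintro rfl
    ext X
    simp

variable [Fintype F]

noncomputable instance : Fintype (unitriangular N F) := Fintype.ofFinite _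

noncomputable instance : Fintype (strictUpper N F) := Fintype.ofFinite _

noncomputable instance : Fintype (Module.Dual F (strictUpper N F)) :=
  have : Finite (Module.Dual F (strictUpper N F)) :=
    Finite.of_injective (fun l => (l : strictUpper N F → F)) DFunLike.coe_injective
  Fintype.ofFinite _

open Classical in
theorem sum_dualChar {θ : AddChar F ℂ} (hθ : θ ≠ 1) (l : Module.Dual F (strictUpper N F)) :
    ∑ X, θ (l X) = if l = 0 then (Fintype.card (strictUpper N F) : ℂ) else 0 := by
  have := AddChar.sum_eq_ite (dualChar θ l)
  simp only [dualChar_apply, dualChar_eq_zero_iff hθ] at this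
  exact this

theorem card_strictUpper :
    Fintype.card (strictUpper N F) = Fintype.card (unitriangular N F) :=
  Fintype.card_congr unitriangularEquiv.symm

theorem coeff_superVector (θ : AddChar F ℂ) (l : Module.Dual F (strictUpper N F))
    (g : unitriangular N F) : (superVector θ l).coeff g = θ (l (unitriangularSubOne g)) := by
  classical
  rw [superVector, finsum_eq_sum_of_fintype, MonoidAlgebra.coeff_sum]
  simp [Finsupp.single_apply]

end Character

/-! ### The modules `ℂG v_λ` and their traces -/

section Supercharacter

variable {N : ℕ} {F : Type*} [Field F] [Fintype F]

/-- Compare coefficients at `h` using `g⁻¹h - 1 = (g⁻¹ - 1) + g⁻¹(h - 1)`: the first summand gives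
the scalar, the second the translated functional. -/
theorem single_mul_superVector (θ : AddChar F ℂ) (l : Module.Dual F (strictUpper N F))
    (g : unitriangular N F) :
    MonoidAlgebra.single g (1 : ℂ) * superVector θ l =
      θ (l (unitriangularSubOne g⁻¹)) • superVector θ (dualTranslate g⁻¹ 1 l) := by
  ext h
  rw [MonoidAlgebra.coeff_smul, Finsupp.smul_apply, coeff_superVector, smul_eq_mul,
    dualTranslate_apply, ← AddChar.map_add_eq_mul, ← map_add, ← one_mul (θ _),
    MonoidAlgebra.coeff_single_mul_apply, coeff_superVector]
  congr 3
  apply Subtype.ext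
  simp [mul_sub]

/-- The coefficient functions are distinct additive characters of `𝔫`, and distinct characters are
linearly independent. -/
theorem linearIndependent_superVector {θ : AddChar F ℂ} (hθ : θ ≠ 1) :
    LinearIndependent ℂ (superVector (N := N) θ) := by
  let f : MonoidAlgebra ℂ (unitriangular N F) →ₗ[ℂ] (strictUpper N F → ℂ) :=
    { toFun x X := x.coeff (unitriangularEquiv.symm X)
      map_add' x y := rfl
      map_smul' c x := rfl }
  have hinj : Function.Injective (dualChar (N := N) θ) := by
    intro l m h
    rw [← sub_eq_zero, ← dualChar_eq_zero_iff hθ]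
    ext X
    have := DFunLike.congr_fun h X
    simp only [dualChar_apply] at this
    simp [AddChar.map_sub_eq_div, this, div_self ((θ.val_isUnit _).ne_zero)]
  apply LinearIndependent.of_comp f
  have hf : f ∘ superVector (N := N) θ = (fun ψ : AddChar (strictUpper N F) ℂ => ⇑ψ) ∘
      dualChar θ := by
    ext l X
    change (superVector θ l).coeff _ = _
    rw [coeff_superVector, ← unitriangularEquiv_apply, Equiv.apply_symm_apply]
    rfl
  rw [hf]
  exact (AddChar.linearIndependent (strictUpper N F) ℂ).comp _ hinj

/-- The left orbit of a functional. -/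
abbrev leftOrbit (l : Module.Dual F (strictUpper N F)) : Set (Module.Dual F (strictUpper N F)) :=
  Set.range fun g : unitriangular N F => dualTranslate g 1 l

theorem superVector_mem_superModule {θ : AddChar F ℂ}
    {l m : Module.Dual F (strictUpper N F)} (hm : m ∈ leftOrbit l) :
    superVector θ m ∈ superModule θ l := by
  obtain ⟨g, rfl⟩ := hm
  have h := single_mul_superVector θ l g⁻¹
  rw [inv_inv] at h
  have h2 : superVector θ (dualTranslate g 1 l) =
      ((θ (l (unitriangularSubOne g)))⁻¹ • MonoidAlgebra.single g⁻¹ (1 : ℂ)) *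
        superVector θ l := by
    rw [smul_mul_assoc, h, smul_smul, inv_mul_cancel₀ (θ.val_isUnit _).ne_zero, one_smul]
  rw [h2]
  exact Submodule.smul_mem _ _ (Submodule.mem_span_singleton_self _)

/-- The basis of `ℂG v_λ` formed by the vectors `v_μ`, for `μ` in the left orbit of `λ`. -/
noncomputable def superModuleBasis {θ : AddChar F ℂ} (hθ : θ ≠ 1)
    (l : Module.Dual F (strictUpper N F)) :
    Module.Basis (leftOrbit l) ℂ (superModule θ l) :=
  Module.Basis.mk (v := fun m => ⟨superVector θ m.1, superVector_mem_superModule m.2⟩)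
    (LinearIndependent.of_comp ((superModule θ l).subtype.restrictScalars ℂ)
      ((linearIndependent_superVector hθ).comp _ Subtype.val_injective)) (by
    set S := Submodule.span ℂ (Set.range fun m : leftOrbit l =>
      (⟨superVector θ m.1, superVector_mem_superModule m.2⟩ : superModule θ l)) with hS
    rintro ⟨x, hx⟩ -
    obtain ⟨r, rfl⟩ := Submodule.mem_span_singleton.1 hx
    have hv : superVector θ l ∈ superModule θ l := Submodule.mem_span_singleton_self _
    change r • (⟨superVector θ l, hv⟩ : superModule θ l) ∈ S
    -- By linearity it is enough to treat multiples of group elements, which send `v_λ` to multiples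
    -- of the vectors of the family.
    induction r using MonoidAlgebra.induction_linear with
    | zero => rw [zero_smul]; exact S.zero_mem
    | add a b ha hb =>
      rw [add_smul]
      exact S.add_mem (ha (Submodule.smul_mem _ _ hv)) (hb (Submodule.smul_mem _ _ hv))
    | single g c =>
      have h1 : MonoidAlgebra.single g c • (⟨superVector θ l, hv⟩ : superModule θ l) =
          (c * θ (l (unitriangularSubOne g⁻¹))) •
            (⟨superVector θ (dualTranslate g⁻¹ 1 l),
              superVector_mem_superModule ⟨g⁻¹, rfl⟩⟩ : superModule θ l) := by
        apply Subtype.ext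
        change MonoidAlgebra.single g c * superVector θ l =
          (c * θ (l (unitriangularSubOne g⁻¹))) • superVector θ (dualTranslate g⁻¹ 1 l)
        rw [mul_smul, ← single_mul_superVector, ← smul_mul_assoc]
        simp
      rw [h1]
      exact S.smul_mem _ (Submodule.subset_span ⟨⟨_, g⁻¹, rfl⟩, rfl⟩))

/-- The character of the module `ℂG v_λ`. -/
noncomputable def superCharacter (θ : AddChar F ℂ) (l : Module.Dual F (strictUpper N F)) :
    unitriangular N F → ℂ :=
  (Representation.ofModule' (k := ℂ) (G := unitriangular N F) (superModule θ l)).character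

open Classical in
-- In the basis of the `v_μ`, `g` acts by a monomial matrix, so the trace only sees the functionals
-- it fixes.
theorem superCharacter_eq_sum_leftOrbit {θ : AddChar F ℂ} (hθ : θ ≠ 1)
    (l : Module.Dual F (strictUpper N F)) (g : unitriangular N F) :
    superCharacter θ l g = ∑ m : leftOrbit l,
      if dualTranslate g⁻¹ 1 m.1 = m.1 then θ (m.1 (unitriangularSubOne g⁻¹)) else 0 := by
  rw [superCharacter, Representation.character,
    LinearMap.trace_eq_matrix_trace ℂ (superModuleBasis hθ l), Matrix.trace]
  refine Finset.sum_congr rfl fun m _ => ?_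
  rw [Matrix.diag_apply, LinearMap.toMatrix_apply]
  have hmem : dualTranslate g⁻¹ 1 m.1 ∈ leftOrbit l := by
    obtain ⟨h, hh⟩ := m.2
    exact ⟨h * g⁻¹, by rw [← hh, dualTranslate_dualTranslate, one_mul]⟩
  have hact : (Representation.ofModule' (k := ℂ) (G := unitriangular N F) (superModule θ l)) g
      (superModuleBasis hθ l m) = θ (m.1 (unitriangularSubOne g⁻¹)) •
        superModuleBasis hθ l ⟨_, hmem⟩ := by
    apply Subtype.ext
    rw [superModuleBasis, Module.Basis.mk_apply, Module.Basis.mk_apply]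
    exact single_mul_superVector θ m.1 g
  rw [hact, map_smul, Module.Basis.repr_self, Finsupp.smul_apply, Finsupp.single_apply]
  simp [Subtype.ext_iff]

end Supercharacter

/-! ### Supercharacters as two-sided orbit sums -/

section Orbits

variable {N : ℕ} {F : Type*} [Field F]

theorem sandwich_left_eq_self_iff (m : Module.Dual F (strictUpper N F))
    (g : unitriangular N F) :
    dualTranslate g 1 m = m ↔ ∀ X, m (strictMul (unitriangularSubOne g) X) = 0 := by
  rw [LinearMap.ext_iff]
  simp only [dualTranslate_apply, sandwich_left, map_add, add_eq_left]

theorem sandwich_right_eq_self_iff (m : Module.Dual F (strictUpper N F))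
    (g : unitriangular N F) :
    dualTranslate 1 g m = m ↔ ∀ X, m (strictMul X (unitriangularSubOne g)) = 0 := by
  rw [LinearMap.ext_iff]
  simp only [dualTranslate_apply, sandwich_right, map_add, add_eq_left]

theorem dualTranslate_inv_eq_self_iff (m : Module.Dual F (strictUpper N F))
    (g h : unitriangular N F) : dualTranslate g⁻¹ h⁻¹ m = m ↔ dualTranslate g h m = m := by
  constructor
  · intro hm
    conv_lhs => rw [← hm]
    simpa using dualTranslate_inv_dualTranslate g⁻¹ h⁻¹ m
  · intro hm
    conv_lhs => rw [← hm]
    exact dualTranslate_inv_dualTranslate g h m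

/-- The functional `Y ↦ m (X Y)`. -/
def leftMulDual (m : Module.Dual F (strictUpper N F)) (X : strictUpper N F) :
    Module.Dual F (strictUpper N F) where
  toFun Y := m (strictMul X Y)
  map_add' Y Z := by rw [strictMul_add, map_add]
  map_smul' c Y := by
    rw [RingHom.id_apply, ← map_smul]
    exact congrArg m (Subtype.ext (Matrix.mul_smul _ _ _))

/-- The functional `Y ↦ m (Y X)`. -/
def rightMulDual (m : Module.Dual F (strictUpper N F)) (X : strictUpper N F) :
    Module.Dual F (strictUpper N F) where
  toFun Y := m (strictMul Y X)
  map_add' Y Z := by rw [add_strictMul, map_add]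
  map_smul' c Y := by
    rw [RingHom.id_apply, ← map_smul]
    exact congrArg m (Subtype.ext (Matrix.smul_mul _ _ _))

theorem leftMulDual_eq_zero_iff (m : Module.Dual F (strictUpper N F)) (g : unitriangular N F) :
    leftMulDual m (unitriangularSubOne g) = 0 ↔ dualTranslate g 1 m = m := by
  rw [sandwich_left_eq_self_iff, LinearMap.ext_iff]
  rfl

theorem rightMulDual_eq_zero_iff (m : Module.Dual F (strictUpper N F)) (g : unitriangular N F) :
    rightMulDual m (unitriangularSubOne g) = 0 ↔ dualTranslate 1 g m = m := by
  rw [sandwich_right_eq_self_iff, LinearMap.ext_iff]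
  rfl

variable [Fintype F]

/-- The sum `∑_{g, h} θ(-l(g X h))`. -/
noncomputable def orbitSum (θ : AddChar F ℂ) (l : Module.Dual F (strictUpper N F))
    (X : strictUpper N F) : ℂ :=
  ∑ g : unitriangular N F, ∑ h : unitriangular N F, θ (-(dualTranslate g h l X))

open Classical in
/-- The order of the stabilizer of a functional under left translations. -/
noncomputable def leftStabCard (l : Module.Dual F (strictUpper N F)) : ℕ :=
  #{g : unitriangular N F | dualTranslate g 1 l = l}

theorem leftStabCard_pos (l : Module.Dual F (strictUpper N F)) : 0 < leftStabCard l := by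
  classical
  exact Finset.card_pos.2 ⟨1, by simp⟩

theorem sum_dualTranslate_left (l : Module.Dual F (strictUpper N F))
    [Fintype (leftOrbit l)] (f : Module.Dual F (strictUpper N F) → ℂ) :
    ∑ g : unitriangular N F, f (dualTranslate g 1 l) =
      leftStabCard l * ∑ m : leftOrbit l, f m.1 := by
  classical
  rw [← Finset.sum_fiberwise_of_maps_to (s := univ) (t := univ)
    (g := fun g => (⟨dualTranslate g 1 l, g, rfl⟩ : leftOrbit l)) (fun _ _ => mem_univ _),
    Finset.mul_sum]
  refine Finset.sum_congr rfl fun m _ => ?_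
  obtain ⟨m, g₀, rfl⟩ := m
  rw [Finset.sum_congr rfl (g := fun _ => f (dualTranslate g₀ 1 l)), Finset.sum_const,
    nsmul_eq_mul]
  · congr 2
    rw [leftStabCard]
    -- The fibre over the translate by `g₀` is the coset of the stabilizer through `g₀`.
    refine Finset.card_bij' (fun g _ => g * g₀⁻¹) (fun g _ => g * g₀) ?_ ?_ ?_ ?_
    · intro g hg
      simp only [mem_filter, mem_univ, true_and, Subtype.ext_iff] at hg ⊢
      have := dualTranslate_dualTranslate g₀⁻¹ 1 g 1 l
      rw [mul_one] at this
      rw [← this, hg, dualTranslate_dualTranslate, mul_inv_cancel, mul_one,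
        dualTranslate_one_one]
    · intro g hg
      simp only [mem_filter, mem_univ, true_and, Subtype.ext_iff] at hg ⊢
      have := dualTranslate_dualTranslate g₀ 1 g 1 l
      rw [mul_one] at this
      rw [← this, hg]
    · intro g _; simp
    · intro g _; simp
  · intro g hg
    exact congrArg f (Subtype.ext_iff.1 (mem_filter.1 hg).2)

open Classical in
-- As `h - 1` runs over all of `𝔫`, orthogonality tests whether `Y ↦ m((g - 1)Y)` vanishes, that is,
-- whether `g` fixes `m` on the left. This replaces the fixed-point condition in the trace by a sum
-- over right translates.
theorem sum_right_translate {θ : AddChar F ℂ} (hθ : θ ≠ 1)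
    (m : Module.Dual F (strictUpper N F)) (g : unitriangular N F) :
    ∑ h : unitriangular N F, θ (-(m (sandwich 1 h (unitriangularSubOne g)))) =
      if dualTranslate g 1 m = m then
        Fintype.card (unitriangular N F) * θ (-(m (unitriangularSubOne g))) else 0 := by
  have h1 : ∀ h : unitriangular N F, θ (-(m (sandwich 1 h (unitriangularSubOne g)))) =
      θ (-(m (unitriangularSubOne g))) *
        θ ((-leftMulDual m (unitriangularSubOne g)) (unitriangularEquiv h)) := by
    intro h
    rw [← AddChar.map_add_eq_mul, sandwich_right, map_add, neg_add]
    rfl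
  simp_rw [h1]
  rw [← Finset.mul_sum, Equiv.sum_comp unitriangularEquiv
    (fun X => θ ((-leftMulDual m (unitriangularSubOne g)) X)), sum_dualChar hθ]
  simp only [neg_eq_zero, leftMulDual_eq_zero_iff, card_strictUpper]
  split_ifs <;> ring

/-- The trace formula is one-sided; trading its fixed-point condition for a sum over right
translates makes both sides appear symmetrically. -/
theorem leftStabCard_mul_superCharacter {θ : AddChar F ℂ} (hθ : θ ≠ 1)
    (l : Module.Dual F (strictUpper N F)) (g : unitriangular N F) :
    leftStabCard l * (Fintype.card (unitriangular N F) : ℂ) * superCharacter θ l g =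
      orbitSum θ l (unitriangularSubOne g) := by
  classical
  rw [superCharacter_eq_sum_leftOrbit hθ, mul_right_comm, ← sum_dualTranslate_left l (fun m =>
    if dualTranslate g⁻¹ 1 m = m then θ (m (unitriangularSubOne g⁻¹)) else 0), Finset.sum_mul,
    orbitSum]
  refine Finset.sum_congr rfl fun h _ => ?_
  have h2 := sum_right_translate hθ (dualTranslate h 1 l) g
  have h3 : ∀ k, dualTranslate h 1 l (sandwich 1 k (unitriangularSubOne g)) =
      dualTranslate h k l (unitriangularSubOne g) := by
    intro k
    rw [dualTranslate_apply, sandwich_sandwich, mul_one, mul_one, dualTranslate_apply]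
  simp_rw [h3] at h2
  rw [h2]
  set m := dualTranslate h 1 l
  have h4 := dualTranslate_inv_eq_self_iff m g 1
  rw [inv_one] at h4
  by_cases hm : dualTranslate g 1 m = m
  -- When `g` fixes `m`, the identity `g⁻¹(g - 1) = -(g⁻¹ - 1)` gives `m(g⁻¹ - 1) = -m(g - 1)`.
  · have h5 : m (sandwich g⁻¹ 1 (unitriangularSubOne g)) = m (unitriangularSubOne g) :=
      DFunLike.congr_fun (h4.2 hm) _
    rw [if_pos hm, if_pos (h4.2 hm), mul_comm, ← h5, ← map_neg]
    congr 3
    apply Subtype.ext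
    simp [mul_sub]
  · rw [if_neg hm, if_neg (fun h => hm (h4.1 h)), zero_mul]

end Orbits

/-! ### Supercharacters are classified by orbits -/

section Orbits

variable {N : ℕ} {F : Type*} [Field F] [Fintype F]

theorem SameOrbit.orbitSum_eq {θ : AddChar F ℂ} {l m : Module.Dual F (strictUpper N F)}
    (h : SameOrbit l m) (X : strictUpper N F) : orbitSum θ l X = orbitSum θ m X := by
  obtain ⟨a, b, rfl⟩ := h
  simp only [orbitSum, dualTranslate_dualTranslate]
  rw [← Equiv.sum_comp (Equiv.mulLeft a)]
  refine Finset.sum_congr rfl fun g _ => ?_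
  rw [← Equiv.sum_comp (Equiv.mulRight b)]
  rfl

theorem SameOrbit.leftStabCard_eq {l m : Module.Dual F (strictUpper N F)}
    (h : SameOrbit l m) : leftStabCard l = leftStabCard m := by
  classical
  obtain ⟨a, b, rfl⟩ := h
  refine Finset.card_bij' (fun g _ => a⁻¹ * g * a) (fun g _ => a * g * a⁻¹) ?_ ?_ ?_ ?_
  · intro g hg
    simp only [mem_filter, mem_univ, true_and] at hg ⊢
    conv_rhs => rw [← hg]
    simp [dualTranslate_dualTranslate, mul_assoc]
  · intro g hg
    simp only [mem_filter, mem_univ, true_and] at hg ⊢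
    apply dualTranslate_injective a b
    conv_rhs => rw [← hg]
    simp [dualTranslate_dualTranslate, mul_assoc]
  · intro g _; group
  · intro g _; group

theorem card_unitriangular_ne_zero : (Fintype.card (unitriangular N F) : ℂ) ≠ 0 := by
  exact_mod_cast Fintype.card_ne_zero

theorem leftStabCard_ne_zero (l : Module.Dual F (strictUpper N F)) :
    (leftStabCard l : ℂ) ≠ 0 := by
  exact_mod_cast (leftStabCard_pos l).ne'

theorem superCharacter_eq {θ : AddChar F ℂ} (hθ : θ ≠ 1)
    (l : Module.Dual F (strictUpper N F)) (g : unitriangular N F) :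
    superCharacter θ l g = ((leftStabCard l : ℂ) * Fintype.card (unitriangular N F))⁻¹ *
      orbitSum θ l (unitriangularSubOne g) := by
  rw [← leftStabCard_mul_superCharacter hθ, inv_mul_cancel_left₀]
  exact mul_ne_zero (leftStabCard_ne_zero l) card_unitriangular_ne_zero

open Classical in
-- This is a Fourier coefficient on `𝔫`: only pairs whose translate of `l` is `m` survive
-- orthogonality.
theorem sum_mul_orbitSum {θ : AddChar F ℂ} (hθ : θ ≠ 1) (l m : Module.Dual F (strictUpper N F)) :
    ∑ X, θ (m X) * orbitSum θ l X = Fintype.card (unitriangular N F) *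
      #{p : unitriangular N F × unitriangular N F | dualTranslate p.1 p.2 l = m} := by
  have h1 : ∀ X, θ (m X) * orbitSum θ l X =
      ∑ p : unitriangular N F × unitriangular N F, θ ((m - dualTranslate p.1 p.2 l) X) := by
    intro X
    rw [orbitSum, ← Fintype.sum_prod_type', Finset.mul_sum]
    refine Finset.sum_congr rfl fun p _ => ?_
    rw [← AddChar.map_add_eq_mul, LinearMap.sub_apply, sub_eq_add_neg]
  simp_rw [h1]
  rw [Finset.sum_comm]
  simp_rw [sum_dualChar hθ, sub_eq_zero, eq_comm (a := m)]
  rw [Finset.sum_ite, Finset.sum_const_zero, add_zero, Finset.sum_const, nsmul_eq_mul,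
    card_strictUpper, mul_comm]

/-- The orbit of `m` can be read off as the set of frequencies of its orbit sum, and a nonzero
factor does not change that set. -/
theorem sameOrbit_of_orbitSum_eq {θ : AddChar F ℂ} (hθ : θ ≠ 1)
    {l m : Module.Dual F (strictUpper N F)} {c : ℂ} (hc : c ≠ 0)
    (h : ∀ X, orbitSum θ l X = c * orbitSum θ m X) : SameOrbit l m := by
  classical
  have h1 := sum_mul_orbitSum hθ l m
  simp_rw [h, mul_left_comm _ c] at h1
  rw [← Finset.mul_sum, sum_mul_orbitSum hθ] at h1
  by_contra hn
  have h0 : #{p : unitriangular N F × unitriangular N F | dualTranslate p.1 p.2 l = m} = 0 :=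
    Finset.card_eq_zero.2 (Finset.filter_eq_empty_iff.2 fun p _ hp => hn ⟨p.1, p.2, hp⟩)
  rw [h0, Nat.cast_zero, mul_zero] at h1
  have h2 := (mul_eq_zero.1 ((mul_eq_zero.1 h1).resolve_left hc)).resolve_left
    card_unitriangular_ne_zero
  have h3 : 0 < #{p : unitriangular N F × unitriangular N F | dualTranslate p.1 p.2 m = m} :=
    Finset.card_pos.2 ⟨(1, 1), by simp⟩
  exact h3.ne' (by exact_mod_cast h2)

theorem superCharacter_eq_iff {θ : AddChar F ℂ} (hθ : θ ≠ 1)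
    {l m : Module.Dual F (strictUpper N F)} :
    superCharacter θ l = superCharacter θ m ↔ SameOrbit l m := by
  constructor
  · intro h
    have hl := mul_ne_zero (leftStabCard_ne_zero l) (card_unitriangular_ne_zero (N := N) (F := F))
    have hm := mul_ne_zero (leftStabCard_ne_zero m) (card_unitriangular_ne_zero (N := N) (F := F))
    refine sameOrbit_of_orbitSum_eq hθ (mul_ne_zero hl (inv_ne_zero hm)) fun X => ?_
    obtain ⟨g, rfl⟩ := unitriangularEquiv.surjective X
    rw [unitriangularEquiv_apply, ← leftStabCard_mul_superCharacter hθ,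
      ← leftStabCard_mul_superCharacter hθ, h, ← mul_assoc, inv_mul_cancel_right₀ hm]
  · intro h
    ext g
    rw [superCharacter_eq hθ, superCharacter_eq hθ, h.orbitSum_eq, h.leftStabCard_eq]

theorem superCharacter_eq_one_of_forall {θ : AddChar F ℂ} (hθ : θ ≠ 1)
    {l : Module.Dual F (strictUpper N F)} {g : unitriangular N F}
    (h : ∀ a b, l (sandwich a b (unitriangularSubOne g)) = 0) :
    superCharacter θ l g = superCharacter θ l 1 := by
  have h1 : unitriangularSubOne (1 : unitriangular N F) = 0 := Subtype.ext (by simp)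
  rw [superCharacter_eq hθ, superCharacter_eq hθ]
  simp [orbitSum, h, h1]

/-- At the identity every term of the orbit sum is 1. A sum of numbers of modulus 1 reaches the
number of its terms only if each is 1; the conclusion is the term of the pair `(1, 1)`. -/
theorem apply_eq_one_of_superCharacter_eq {θ : AddChar F ℂ} (hθ : θ ≠ 1)
    {l : Module.Dual F (strictUpper N F)} {g : unitriangular N F}
    (h : superCharacter θ l g = superCharacter θ l 1) :
    θ (l (unitriangularSubOne g)) = 1 := by
  have h1 : unitriangularSubOne (1 : unitriangular N F) = 0 := Subtype.ext (by simp)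
  have hnorm : ∀ x, ‖θ x‖ = 1 := fun x => AddChar.norm_apply θ x
  have h2 := leftStabCard_mul_superCharacter hθ l g
  rw [h, leftStabCard_mul_superCharacter hθ, h1, orbitSum, orbitSum,
    ← Fintype.sum_prod_type', ← Fintype.sum_prod_type'] at h2
  have h3 := congrArg Complex.re h2
  simp only [map_zero, neg_zero, AddChar.map_zero_eq_one, Complex.re_sum] at h3
  have h4 := (Finset.sum_eq_sum_iff_of_le (fun p _ => (Complex.re_le_norm _).trans
    (hnorm _).le)).1 h3.symm (1, 1) (mem_univ _)
  have h5 : θ (-(l (unitriangularSubOne g))) = 1 := by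
    have h6 := hnorm (-(l (unitriangularSubOne g)))
    simp only [dualTranslate_one_one] at h4
    have h7 := Complex.re_eq_norm.1 (h4.trans h6.symm)
    rw [Complex.eq_re_of_ofReal_le h7, h4, Complex.ofReal_one]
  rw [AddChar.map_neg_eq_inv, inv_eq_one] at h5
  exact h5

end Orbits

/-! ### `C`-invariance as stability of an orbit under translation -/

section SuperdiagonalInvariance

variable {n : ℕ} {F : Type*} [Field F]

/-- The sum of the entries on the first superdiagonal. -/
def superdiagDual : Module.Dual F (strictUpper (n + 1) F) where
  toFun X := ∑ i : Fin n, X.1 i.castSucc i.succ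
  map_add' X Y := by simp [Finset.sum_add_distrib]
  map_smul' c X := by simp [Finset.mul_sum]

theorem superdiagSum_eq (g : unitriangular (n + 1) F) :
    superdiagSum g = superdiagDual (unitriangularSubOne g) := by
  refine Finset.sum_congr rfl fun i _ => ?_
  simp [Matrix.one_apply_ne (Fin.castSucc_lt_succ (i := i)).ne]

theorem sandwich_superdiag (g h : unitriangular (n + 1) F) (X : strictUpper (n + 1) F)
    (i : Fin n) : (sandwich g h X).1 i.castSucc i.succ = X.1 i.castSucc i.succ := by
  rw [coe_sandwich, Matrix.mul_apply, Finset.sum_eq_single i.succ, Matrix.mul_apply,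
    Finset.sum_eq_single i.castSucc, g.2.2, h.2.2, one_mul, mul_one]
  · intro k _ hk
    rcases lt_or_gt_of_ne hk with hk | hk
    · rw [g.2.1 _ _ hk, zero_mul]
    · rw [X.2 _ _ (Fin.castSucc_lt_iff_succ_le.1 hk), mul_zero]
  · simp
  · intro k _ hk
    rcases lt_or_gt_of_ne hk with hk | hk
    · rw [upper_mul_strictUpper g.2.1 X.2 i.castSucc k (Fin.le_castSucc_iff.2 hk), zero_mul]
    · rw [h.2.1 _ _ hk, mul_zero]
  · simp

theorem dualTranslate_superdiagDual (g h : unitriangular (n + 1) F) :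
    dualTranslate g h (superdiagDual : Module.Dual F (strictUpper (n + 1) F)) =
      superdiagDual := by
  ext X
  change ∑ i : Fin n, (sandwich g h X).1 i.castSucc i.succ = ∑ i : Fin n, X.1 i.castSucc i.succ
  exact Finset.sum_congr rfl fun i _ => sandwich_superdiag g h X i

variable [Fintype F]

/-- The superdiagonal functional is fixed by all translations, so it factors out of the sum.
Subtracting it gives a positive exponent because orbit sums are formed with `θ(-·)`. -/
theorem orbitSum_sub_superdiagDual (θ : AddChar F ℂ) (l : Module.Dual F (strictUpper (n + 1) F))
    (t : F) (X : strictUpper (n + 1) F) :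
    orbitSum θ (l - t • superdiagDual) X = θ (t * superdiagDual X) * orbitSum θ l X := by
  simp only [orbitSum, Finset.mul_sum]
  refine Finset.sum_congr rfl fun g _ => Finset.sum_congr rfl fun h _ => ?_
  rw [← AddChar.map_add_eq_mul]
  congr 1
  have := DFunLike.congr_fun (dualTranslate_superdiagDual (F := F) g h) X
  simp only [dualTranslate_apply] at this
  simp only [dualTranslate_apply, LinearMap.sub_apply, LinearMap.smul_apply, this, smul_eq_mul]
  ring

/-- The orbit condition only involves the characters `x ↦ θ(t x)`, whereas `C` allows every `ϑ`.
Stability already makes the character vanish wherever `σ` is nonzero, since there some `θ(t σ(g))`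
differs from 1; where `σ` is zero all of `C` takes the value 1. -/
theorem isCInvariant_superCharacter_iff {θ : AddChar F ℂ} (hθ : θ ≠ 1)
    (l : Module.Dual F (strictUpper (n + 1) F)) :
    IsCInvariant (superCharacter θ l) ↔ ∀ t : F, SameOrbit l (l - t • superdiagDual) := by
  constructor
  · intro h t
    refine (sameOrbit_of_orbitSum_eq hθ one_ne_zero fun X => ?_).symm
    obtain ⟨g, rfl⟩ := unitriangularEquiv.surjective X
    have h1 := congrFun (h (fun g => AddChar.mulShift θ t (superdiagSum g)) ⟨_, fun _ => rfl⟩) g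
    rw [Pi.mul_apply, AddChar.mulShift_apply, superdiagSum_eq] at h1
    rw [orbitSum_sub_superdiagDual, unitriangularEquiv_apply, one_mul,
      ← leftStabCard_mul_superCharacter hθ, mul_left_comm, h1]
  · rintro h ψ ⟨ϑ, hϑ⟩
    ext g
    rw [Pi.mul_apply, hϑ, superdiagSum_eq]
    by_cases hσ : superdiagDual (unitriangularSubOne g) = 0
    · rw [hσ, AddChar.map_zero_eq_one, one_mul]
    · obtain ⟨t, ht⟩ := exists_apply_mul_ne_one hθ hσ
      have h1 := (h t).orbitSum_eq (θ := θ) (unitriangularSubOne g)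
      rw [orbitSum_sub_superdiagDual] at h1
      have h2 : orbitSum θ l (unitriangularSubOne g) = 0 := by
        by_contra h0
        exact ht (mul_eq_right₀ h0 |>.1 h1.symm)
      rw [superCharacter_eq hθ, h2, mul_zero, mul_zero]

end SuperdiagonalInvariance

/-! ### Irreducibility in terms of left and right orbits -/

section IrreducibleSupercharacters

variable {N : ℕ} {F : Type*} [Field F] [Fintype F]

open Classical in
-- The two stabilizers are the left and right radicals of the bilinear form `(X, Y) ↦ l(XY)`, and
-- summing `θ(l(XY))` in the two orders measures each of them.
theorem card_rightStab {θ : AddChar F ℂ} (hθ : θ ≠ 1) (l : Module.Dual F (strictUpper N F)) :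
    #{h : unitriangular N F | dualTranslate 1 h l = l} = leftStabCard l := by
  have hL : ∑ X, ∑ Y, θ (l (strictMul X Y)) =
      (leftStabCard l : ℂ) * Fintype.card (unitriangular N F) := by
    rw [← Equiv.sum_comp unitriangularEquiv]
    have : ∀ g : unitriangular N F, ∑ Y, θ (l (strictMul (unitriangularEquiv g) Y)) =
        if dualTranslate g 1 l = l then (Fintype.card (unitriangular N F) : ℂ) else 0 := by
      intro g
      have h1 := sum_dualChar hθ (leftMulDual l (unitriangularSubOne g))
      simp only [leftMulDual_eq_zero_iff, card_strictUpper] at h1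
      exact h1
    simp_rw [this]
    rw [Finset.sum_ite, Finset.sum_const_zero, add_zero, Finset.sum_const, nsmul_eq_mul]
    rfl
  have hR : ∑ X, ∑ Y, θ (l (strictMul X Y)) =
      (#{h : unitriangular N F | dualTranslate 1 h l = l} : ℂ) *
        Fintype.card (unitriangular N F) := by
    rw [Finset.sum_comm, ← Equiv.sum_comp unitriangularEquiv]
    have : ∀ g : unitriangular N F, ∑ Y, θ (l (strictMul Y (unitriangularEquiv g))) =
        if dualTranslate 1 g l = l then (Fintype.card (unitriangular N F) : ℂ) else 0 := by
      intro g
      have h1 := sum_dualChar hθ (rightMulDual l (unitriangularSubOne g))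
      simp only [rightMulDual_eq_zero_iff, card_strictUpper] at h1
      exact h1
    simp_rw [this]
    rw [Finset.sum_ite, Finset.sum_const_zero, add_zero, Finset.sum_const, nsmul_eq_mul]
  rw [hL] at hR
  exact_mod_cast (mul_right_cancel₀ card_unitriangular_ne_zero hR).symm

/-- Replace `a` by `ag` and use `g(g⁻¹ - 1) = -(g - 1)`. This writes the values at inverses as sums
of additive characters in `g - 1`. -/
theorem orbitSum_inv (θ : AddChar F ℂ) (l : Module.Dual F (strictUpper N F))
    (g : unitriangular N F) :
    orbitSum θ l (unitriangularSubOne g⁻¹) = ∑ p : unitriangular N F × unitriangular N F,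
      θ (dualTranslate p.1 p.2 l (unitriangularSubOne g)) := by
  rw [orbitSum, Fintype.sum_prod_type, ← Equiv.sum_comp (Equiv.mulRight g)]
  refine Finset.sum_congr rfl fun a _ => Finset.sum_congr rfl fun b _ => ?_
  congr 1
  rw [dualTranslate_apply, dualTranslate_apply, ← map_neg]
  congr 1
  apply Subtype.ext
  simp [mul_sub, sub_mul, mul_assoc]

open Classical in
-- Expanding the second factor by `orbitSum_inv` gives Fourier coefficients of the orbit sum at
-- points of its own orbit, each of which counts a fibre of the orbit map.
theorem sum_superCharacter_mul_inv {θ : AddChar F ℂ} (hθ : θ ≠ 1)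
    (l : Module.Dual F (strictUpper N F)) :
    (leftStabCard l : ℂ) ^ 2 * ∑ g, superCharacter θ l g * superCharacter θ l g⁻¹ =
      Fintype.card (unitriangular N F) *
        #{p : unitriangular N F × unitriangular N F | dualTranslate p.1 p.2 l = l} := by
  set T := #{p : unitriangular N F × unitriangular N F | dualTranslate p.1 p.2 l = l} with hT
  -- All fibres of the orbit map are translates of the two-sided stabilizer.
  have hcard : ∀ p : unitriangular N F × unitriangular N F,
      #{q : unitriangular N F × unitriangular N F |
        dualTranslate q.1 q.2 l = dualTranslate p.1 p.2 l} = T := by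
    intro p
    refine Finset.card_bij' (fun q _ => (q.1 * p.1⁻¹, p.2⁻¹ * q.2))
      (fun q _ => (q.1 * p.1, p.2 * q.2)) ?_ ?_ ?_ ?_
    · intro q hq
      simp only [mem_filter, mem_univ, true_and] at hq ⊢
      rw [← dualTranslate_dualTranslate, hq, dualTranslate_inv_dualTranslate]
    · intro q hq
      simp only [mem_filter, mem_univ, true_and] at hq ⊢
      rw [← dualTranslate_dualTranslate, hq]
    · intro q _; simp
    · intro q _; simp
  have h1 : ∑ g, orbitSum θ l (unitriangularSubOne g) * orbitSum θ l (unitriangularSubOne g⁻¹) =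
      (Fintype.card (unitriangular N F) : ℂ) ^ 3 * T := by
    have h2 : ∀ g : unitriangular N F,
        orbitSum θ l (unitriangularSubOne g) * orbitSum θ l (unitriangularSubOne g⁻¹) =
        ∑ p : unitriangular N F × unitriangular N F,
          θ (dualTranslate p.1 p.2 l (unitriangularEquiv g)) *
            orbitSum θ l (unitriangularEquiv g) := by
      intro g
      rw [orbitSum_inv, mul_comm, Finset.sum_mul]
      rfl
    simp_rw [h2]
    rw [Equiv.sum_comp unitriangularEquiv (fun X => ∑ p : unitriangular N F × unitriangular N F,
          θ (dualTranslate p.1 p.2 l X) * orbitSum θ l X), Finset.sum_comm]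
    simp_rw [sum_mul_orbitSum hθ, hcard]
    rw [Finset.sum_const, card_univ, Fintype.card_prod, nsmul_eq_mul]
    push_cast
    ring
  simp_rw [← leftStabCard_mul_superCharacter hθ] at h1
  have h3 : (Fintype.card (unitriangular N F) : ℂ) ^ 2 ≠ 0 :=
    pow_ne_zero 2 card_unitriangular_ne_zero
  apply mul_left_cancel₀ h3
  rw [← mul_assoc, ← mul_assoc, ← pow_succ, ← h1, Finset.mul_sum]
  refine Finset.sum_congr rfl fun g _ => ?_
  ring

/-- The norm is 1 exactly when the two-sided stabilizer is as small as possible, namely the product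
of the left and right ones. An extra element `(g, k⁻¹)` is the same as a common point of the left
and right orbits other than `l`. -/
theorem isIrreducibleCharacter_superCharacter_iff {θ : AddChar F ℂ} (hθ : θ ≠ 1)
    (l : Module.Dual F (strictUpper N F)) :
    IsIrreducibleCharacter (superCharacter θ l) ↔
      ∀ g h : unitriangular N F, dualTranslate g 1 l = dualTranslate 1 h l →
        dualTranslate g 1 l = l := by
  classical
  have hfin : Module.Finite ℂ (superModule θ l) :=
    Module.Finite.of_basis (superModuleBasis hθ l)
  have hirr : IsIrreducibleCharacter (superCharacter θ l) ↔
      ∑ g, superCharacter θ l g * superCharacter θ l g⁻¹ = Nat.card (unitriangular N F) :=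
    isIrreducibleCharacter_iff_norm_eq_one _
  set L := ({g : unitriangular N F | dualTranslate g 1 l = l} : Finset _) with hL
  set R := ({h : unitriangular N F | dualTranslate 1 h l = l} : Finset _) with hR
  set T := ({p : unitriangular N F × unitriangular N F | dualTranslate p.1 p.2 l = l} :
    Finset _) with hT
  have hsplit : ∀ g h : unitriangular N F,
      dualTranslate g h l = dualTranslate 1 h (dualTranslate g 1 l) := fun g h => by
    rw [dualTranslate_dualTranslate, mul_one, mul_one]
  have hsub : L ×ˢ R ⊆ T := by
    rintro ⟨g, h⟩ hp
    simp only [hL, hR, hT, mem_product, mem_filter, mem_univ, true_and] at hp ⊢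
    rw [hsplit, hp.1, hp.2]
  have hcardR : #R = leftStabCard l := card_rightStab hθ l
  have hcardL : #L = leftStabCard l := rfl
  have hnorm := sum_superCharacter_mul_inv hθ l
  rw [hirr, Nat.card_eq_fintype_card]
  have h1 : ∑ g, superCharacter θ l g * superCharacter θ l g⁻¹ =
      Fintype.card (unitriangular N F) ↔ #(L ×ˢ R) = #T := by
    rw [card_product, hcardR, hcardL]
    constructor
    · intro h
      rw [h, mul_comm] at hnorm
      have := mul_left_cancel₀ card_unitriangular_ne_zero hnorm
      rw [sq] at this
      exact_mod_cast this
    · intro h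
      apply mul_left_cancel₀ (pow_ne_zero 2 (leftStabCard_ne_zero l))
      rw [hnorm, ← h]
      push_cast
      ring
  rw [h1]
  constructor
  · intro h g k hgk
    have hmem : (g, k⁻¹) ∈ T := by
      simp only [hT, mem_filter, mem_univ, true_and]
      have := dualTranslate_inv_dualTranslate 1 k l
      rw [inv_one] at this
      rw [hsplit, hgk, this]
    rw [← Finset.eq_of_subset_of_card_le hsub h.ge, mem_product] at hmem
    exact (mem_filter.1 hmem.1).2
  · intro h
    congr 1
    refine Finset.Subset.antisymm hsub ?_
    rintro ⟨g, k⟩ hp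
    simp only [hL, hR, hT, mem_product, mem_filter, mem_univ, true_and] at hp ⊢
    have h2 : dualTranslate g 1 l = dualTranslate 1 k⁻¹ l := by
      conv_rhs => rw [← hp]
      rw [dualTranslate_dualTranslate, mul_one, inv_mul_cancel]
    have h3 := h _ _ h2
    refine ⟨h3, ?_⟩
    rw [hsplit, h3] at hp
    exact hp

end IrreducibleSupercharacters

/-! ### Matrix coordinates and uniqueness of normal forms -/

section Coordinates

variable {N : ℕ} {F : Type*} [Field F]

/-- The matrix unit `E_{ij}` as an element of `𝔲_N(F)`. -/
def strictSingle (i j : Fin N) (hij : i < j) (c : F) : strictUpper N F :=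
  ⟨Matrix.single i j c, fun a b hba => by
    rw [Matrix.single_apply, if_neg]
    rintro ⟨rfl, rfl⟩
    exact absurd hij hba.not_gt⟩

@[simp] theorem coe_strictSingle (i j : Fin N) (hij : i < j) (c : F) :
    (strictSingle i j hij c : Matrix (Fin N) (Fin N) F) = Matrix.single i j c := rfl

/-- The functional `X ↦ ∑ M_{ij} X_{ij}`. -/
def dualOf (M : strictUpper N F) : Module.Dual F (strictUpper N F) where
  toFun X := ∑ i, ∑ j, M.1 i j * X.1 i j
  map_add' X Y := by simp [mul_add, Finset.sum_add_distrib]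
  map_smul' c X := by simp [Finset.mul_sum, mul_left_comm]

theorem dualOf_apply (M X : strictUpper N F) : dualOf M X = ∑ i, ∑ j, M.1 i j * X.1 i j := rfl

theorem dualOf_strictSingle (M : strictUpper N F) {i j : Fin N} (hij : i < j) (c : F) :
    dualOf M (strictSingle i j hij c) = M.1 i j * c := by
  rw [dualOf_apply, Finset.sum_eq_single i, Finset.sum_eq_single j]
  · simp
  · intro b _ hb
    simp [hb.symm]
  · simp
  · intro a _ ha
    simp [ha.symm]
  · simp

theorem dual_ext {l m : Module.Dual F (strictUpper N F)}
    (h : ∀ (i j : Fin N) (hij : i < j),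
      l (strictSingle i j hij 1) = m (strictSingle i j hij 1)) : l = m := by
  ext X
  have hX : X = ∑ i, ∑ j, if hij : i < j then X.1 i j • strictSingle i j hij 1 else 0 := by
    apply Subtype.ext
    ext a b
    have hs : ((∑ i, ∑ j, if hij : i < j then X.1 i j • strictSingle i j hij (1 : F) else 0 :
        strictUpper N F) : Matrix (Fin N) (Fin N) F) a b =
        ∑ i, ∑ j, (if hij : i < j then X.1 i j • strictSingle i j hij (1 : F) else 0 :
          strictUpper N F).1 a b := by
      simp [Matrix.sum_apply]
    rw [hs, Finset.sum_eq_single a, Finset.sum_eq_single b]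
    · split_ifs with h
      · simp
      · simpa using X.2 a b (not_lt.1 h)
    · intro j _ hj
      split_ifs
      · simp [hj]
      · rfl
    · simp
    · intro i _ hi
      refine Finset.sum_eq_zero fun j _ => ?_
      split_ifs
      · simp [hi]
      · rfl
    · simp
  rw [hX, map_sum, map_sum]
  refine Finset.sum_congr rfl fun i _ => ?_
  rw [map_sum, map_sum]
  refine Finset.sum_congr rfl fun j _ => ?_
  split_ifs with hij
  · rw [map_smul, map_smul, h]
  · rw [map_zero, map_zero]

theorem dualOf_surjective : Function.Surjective (dualOf (N := N) (F := F)) := by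
  intro l
  refine ⟨⟨fun i j => if hij : i < j then l (strictSingle i j hij 1) else 0,
    fun i j hji => dif_neg hji.not_gt⟩, dual_ext fun i j hij => ?_⟩
  rw [dualOf_strictSingle, mul_one]
  exact dif_pos hij

theorem dualOf_sandwich_single (M : strictUpper N F) (g h : unitriangular N F) {i j : Fin N}
    (hij : i < j) : dualOf M (sandwich g h (strictSingle i j hij 1)) =
      ∑ a, ∑ b, M.1 a b * (g.1.1 a i * h.1.1 j b) := by
  rw [dualOf_apply]
  refine Finset.sum_congr rfl fun a _ => Finset.sum_congr rfl fun b _ => ?_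
  rw [coe_sandwich, coe_strictSingle, Matrix.mul_assoc, Matrix.mul_apply,
    Finset.sum_eq_single i, Matrix.single_mul_apply_same, one_mul]
  · intro k _ hk
    rw [Matrix.single_mul_apply_of_ne _ _ _ _ _ hk, mul_zero]
  · simp

/-- Left translation adds multiples of higher rows to lower ones; right translation, below, adds
multiples of columns to those on their left. Only entries above the diagonal matter. -/
theorem dualOf_sandwich_left (M : strictUpper N F) (g : unitriangular N F) {i j : Fin N}
    (hij : i < j) : dualOf M (sandwich g 1 (strictSingle i j hij 1)) =
      M.1 i j + ∑ a ∈ univ.filter (· < i), M.1 a j * g.1.1 a i := by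
  have h1 : ∀ a, ∑ b, M.1 a b * (g.1.1 a i * (1 : unitriangular N F).1.1 j b) =
      M.1 a j * g.1.1 a i := by
    intro a
    rw [Finset.sum_eq_single j]
    · simp
    · intro b _ hb
      simp [Matrix.one_apply_ne hb.symm]
    · simp
  rw [dualOf_sandwich_single]
  simp_rw [h1]
  rw [← Finset.add_sum_erase _ _ (mem_univ i), g.2.2, mul_one]
  congr 1
  symm
  apply Finset.sum_subset_zero_on_sdiff
  · intro a ha
    simp only [mem_filter, mem_univ, true_and] at ha
    simp [ha.ne]
  · intro a ha
    simp only [mem_sdiff, mem_erase, mem_univ, and_true, mem_filter, true_and, not_lt] at ha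
    rw [g.2.1 a i (lt_of_le_of_ne ha.2 (Ne.symm ha.1)), mul_zero]
  · intros; rfl

theorem dualOf_sandwich_right (M : strictUpper N F) (h : unitriangular N F) {i j : Fin N}
    (hij : i < j) : dualOf M (sandwich 1 h (strictSingle i j hij 1)) =
      M.1 i j + ∑ b ∈ univ.filter (j < ·), M.1 i b * h.1.1 j b := by
  have h1 : ∀ a, ∑ b, M.1 a b * ((1 : unitriangular N F).1.1 a i * h.1.1 j b) =
      if a = i then ∑ b, M.1 i b * h.1.1 j b else 0 := by
    intro a
    split_ifs with ha
    · subst ha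
      simp
    · simp [Matrix.one_apply_ne ha]
  rw [dualOf_sandwich_single]
  simp_rw [h1]
  rw [Finset.sum_ite_eq' univ i, if_pos (mem_univ i), ← Finset.add_sum_erase _ _ (mem_univ j),
    h.2.2, mul_one]
  congr 1
  symm
  apply Finset.sum_subset_zero_on_sdiff
  · intro a ha
    simp only [mem_filter, mem_univ, true_and] at ha
    simp [ha.ne']
  · intro a ha
    simp only [mem_sdiff, mem_erase, mem_univ, and_true, mem_filter, true_and, not_lt] at ha
    rw [h.2.1 j a (lt_of_le_of_ne ha.2 ha.1), mul_zero]
  · intros; rfl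

/-- A matrix with at most one nonzero entry in each row and in each column. -/
def IsQuasiMonomial (M : strictUpper N F) : Prop :=
  (∀ i j j', M.1 i j ≠ 0 → M.1 i j' ≠ 0 → j = j') ∧
    ∀ i i' j, M.1 i j ≠ 0 → M.1 i' j ≠ 0 → i = i'

/-- With one group element moved across, a row-reduced `L` equals a column-reduced `M`; entries are
then compared starting from the top right corner. -/
theorem IsQuasiMonomial.eq_of_sameOrbit {L M : strictUpper N F} (hL : IsQuasiMonomial L)
    (hM : IsQuasiMonomial M) (h : SameOrbit (dualOf L) (dualOf M)) : L = M := by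
  obtain ⟨g, h, hgh⟩ := h
  have h1 : dualTranslate g 1 (dualOf L) = dualTranslate 1 h⁻¹ (dualOf M) := by
    rw [← hgh, dualTranslate_dualTranslate, mul_one, inv_mul_cancel]
  -- `d` measures the distance to the top right corner, so it drops when moving up or to the right.
  have key : ∀ d (i j : Fin N), i < j → i.val + (N - j.val) = d → L.1 i j = M.1 i j := by
    intro d
    induction d using Nat.strong_induction_on with
    | _ d ih =>
      intro i j hij hd
      have h2 := DFunLike.congr_fun h1 (strictSingle i j hij 1)
      rw [dualTranslate_apply, dualTranslate_apply, dualOf_sandwich_left,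
        dualOf_sandwich_right] at h2
      have ihc : ∀ a, a < i → L.1 a j = M.1 a j := fun a ha =>
        ih (a.val + (N - j.val)) (by omega) a j (ha.trans hij) rfl
      have ihr : ∀ b, j < b → L.1 i b = M.1 i b := fun b hb =>
        ih (i.val + (N - b.val)) (by omega) i b (hij.trans hb) rfl
      by_cases h0 : L.1 i j = 0 ∧ M.1 i j = 0
      · rw [h0.1, h0.2]
      -- A nonzero entry of either matrix at `(i, j)` clears the rest of its row and column there;
      -- the induction hypothesis carries this to the other matrix, so both correction sums vanish.
      · have hz : (∀ a, a < i → L.1 a j = 0) ∧ ∀ b, j < b → M.1 i b = 0 := by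
          rcases not_and_or.1 h0 with h0 | h0
          · refine ⟨fun a ha => ?_, fun b hb => ?_⟩
            · by_contra hne
              exact ha.ne (hL.2 a i j hne h0)
            · rw [← ihr b hb]
              by_contra hne
              exact hb.ne' (hL.1 i b j hne h0)
          · refine ⟨fun a ha => ?_, fun b hb => ?_⟩
            · rw [ihc a ha]
              by_contra hne
              exact ha.ne (hM.2 a i j hne h0)
            · by_contra hne
              exact hb.ne' (hM.1 i b j hne h0)
        rwa [Finset.sum_eq_zero, Finset.sum_eq_zero, add_zero, add_zero] at h2
        · intro b hb
          rw [hz.2 b (by simpa using hb), zero_mul]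
        · intro a ha
          rw [hz.1 a (by simpa using ha), zero_mul]
  apply Subtype.ext
  ext i j
  rcases lt_or_ge i j with hij | hji
  · exact key _ i j hij rfl
  · rw [L.2 i j hji, M.2 i j hji]

/-- The element `1 + c E_{ij}` of `U_N(F)`. -/
noncomputable def elementary (i j : Fin N) (hij : i < j) (c : F) : unitriangular N F :=
  unitriangularEquiv.symm (strictSingle i j hij c)

theorem unitriangularSubOne_elementary (i j : Fin N) (hij : i < j) (c : F) :
    unitriangularSubOne (elementary i j hij c) = strictSingle i j hij c :=
  unitriangularEquiv.apply_symm_apply _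

theorem coe_elementary (i j : Fin N) (hij : i < j) (c : F) :
    (elementary i j hij c).1.1 = 1 + Matrix.single i j c := by
  have := congrArg Subtype.val (unitriangularSubOne_elementary i j hij c)
  rw [coe_unitriangularSubOne, coe_strictSingle] at this
  rw [← this, add_sub_cancel]

theorem dualOf_elementary_left (M : strictUpper N F) {p q i j : Fin N} (hpq : p < q) (c : F)
    (hij : i < j) : dualOf M (sandwich (elementary p q hpq c) 1 (strictSingle i j hij 1)) =
      M.1 i j + if i = q then M.1 p j * c else 0 := by
  rw [dualOf_sandwich_left]
  congr 1
  split_ifs with h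
  · subst h
    rw [Finset.sum_eq_single p]
    · simp [coe_elementary, Matrix.one_apply_ne hpq.ne]
    · intro b hb hbp
      simp only [mem_filter, mem_univ, true_and] at hb
      simp [coe_elementary, Matrix.one_apply_ne hb.ne, hbp.symm]
    · simp [hpq]
  · refine Finset.sum_eq_zero fun b hb => ?_
    simp only [mem_filter, mem_univ, true_and] at hb
    simp [coe_elementary, Matrix.one_apply_ne hb.ne, Ne.symm h]

theorem dualOf_elementary_right (M : strictUpper N F) {p q i j : Fin N} (hpq : p < q) (c : F)
    (hij : i < j) : dualOf M (sandwich 1 (elementary p q hpq c) (strictSingle i j hij 1)) =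
      M.1 i j + if j = p then M.1 i q * c else 0 := by
  rw [dualOf_sandwich_right]
  congr 1
  split_ifs with h
  · subst h
    rw [Finset.sum_eq_single q]
    · simp [coe_elementary, Matrix.one_apply_ne hpq.ne]
    · intro b hb hbp
      simp only [mem_filter, mem_univ, true_and] at hb
      simp [coe_elementary, Matrix.one_apply_ne hb.ne, hbp.symm]
    · simp [hpq]
  · refine Finset.sum_eq_zero fun b hb => ?_
    simp only [mem_filter, mem_univ, true_and] at hb
    simp [coe_elementary, Matrix.one_apply_ne hb.ne, Ne.symm h]

end Coordinates

/-! ### Existence of normal forms -/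

section NormalForm

variable {N : ℕ} {F : Type*} [Field F]

open Classical in
/-- The set of positions of the nonzero entries. -/
noncomputable def support (M : strictUpper N F) : Finset (Fin N × Fin N) :=
  univ.filter fun p => M.1 p.1 p.2 ≠ 0

theorem mem_support {M : strictUpper N F} {p : Fin N × Fin N} :
    p ∈ support M ↔ M.1 p.1 p.2 ≠ 0 := by
  classical
  simp [support]

theorem lt_of_ne_zero {M : strictUpper N F} {i j : Fin N} (h : M.1 i j ≠ 0) : i < j := by
  by_contra hij
  exact h (M.2 i j (not_lt.1 hij))

/-- The sum of `2 ^ (j - i)` over the positions `(i, j)` of the nonzero entries. -/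
noncomputable def supportWeight (M : strictUpper N F) : ℕ :=
  ∑ p ∈ support M, 2 ^ (p.2.val - p.1.val)

theorem sum_two_pow_lt {ι : Type*} (s : Finset ι) (f : ι → ℕ) (hf : Set.InjOn f s) (d : ℕ)
    (hd : ∀ x ∈ s, f x < d) : ∑ x ∈ s, 2 ^ f x < 2 ^ d := by
  classical
  rw [← Finset.sum_image (f := fun k => 2 ^ k) (g := f) hf]
  exact Nat.geomSum_lt le_rfl (by
    intro k hk
    obtain ⟨x, hx, rfl⟩ := Finset.mem_image.1 hk
    exact hd x hx)

theorem supportWeight_lt {M M' : strictUpper N F} {i j : Fin N} (hij : M.1 i j ≠ 0)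
    (hij' : M'.1 i j = 0) (s : Finset (Fin N × Fin N))
    (hs : ∀ p, M'.1 p.1 p.2 ≠ 0 → M.1 p.1 p.2 = 0 → p ∈ s)
    (hw : ∑ p ∈ s, 2 ^ (p.2.val - p.1.val) < 2 ^ (j.val - i.val)) :
    supportWeight M' < supportWeight M := by
  classical
  calc supportWeight M' ≤ ∑ p ∈ (support M).erase (i, j) ∪ s, 2 ^ (p.2.val - p.1.val) := by
        refine Finset.sum_le_sum_of_subset fun p hp => ?_
        rw [mem_support] at hp
        rw [mem_union, mem_erase, mem_support]
        by_cases h : M.1 p.1 p.2 = 0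
        · exact Or.inr (hs p hp h)
        · left
          refine ⟨?_, h⟩
          rintro rfl
          exact hp hij'
    _ ≤ ∑ p ∈ (support M).erase (i, j), 2 ^ (p.2.val - p.1.val) +
          ∑ p ∈ s, 2 ^ (p.2.val - p.1.val) := by
        rw [← Finset.sum_union_inter]
        exact Nat.le_add_right _ _
    _ < ∑ p ∈ (support M).erase (i, j), 2 ^ (p.2.val - p.1.val) + 2 ^ (j.val - i.val) := by
        gcongr
    _ = supportWeight M :=
        Finset.sum_erase_add (support M) (fun p => 2 ^ (p.2.val - p.1.val))
          (a := (i, j)) (mem_support.2 hij)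

/-- Clear a longest nonzero entry `(i, j)` that has another one above it or to its right. The
operation creates entries only in row `i` (or column `j`), shorter than `j - i` and of distinct
lengths, so powers of two as weights make the removed entry outweigh them all. -/
theorem exists_supportWeight_lt {M : strictUpper N F} (hM : ¬ IsQuasiMonomial M) :
    ∃ M', SameOrbit (dualOf M) (dualOf M') ∧ supportWeight M' < supportWeight M := by
  classical
  let K : Finset (Fin N × Fin N) := (support M).filter fun p =>
    (∃ a, a < p.1 ∧ M.1 a p.2 ≠ 0) ∨ ∃ b, p.2 < b ∧ M.1 p.1 b ≠ 0
  have hK : K.Nonempty := by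
    rw [IsQuasiMonomial, not_and_or] at hM
    rcases hM with hM | hM
    · push Not at hM
      obtain ⟨i, j, j', h1, h2, h3⟩ := hM
      rcases lt_or_gt_of_ne h3 with h3 | h3
      · exact ⟨(i, j), mem_filter.2 ⟨mem_support.2 h1, Or.inr ⟨j', h3, h2⟩⟩⟩
      · exact ⟨(i, j'), mem_filter.2 ⟨mem_support.2 h2, Or.inr ⟨j, h3, h1⟩⟩⟩
    · push Not at hM
      obtain ⟨i, i', j, h1, h2, h3⟩ := hM
      rcases lt_or_gt_of_ne h3 with h3 | h3
      · exact ⟨(i', j), mem_filter.2 ⟨mem_support.2 h2, Or.inl ⟨i, h3, h1⟩⟩⟩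
      · exact ⟨(i, j), mem_filter.2 ⟨mem_support.2 h1, Or.inl ⟨i', h3, h2⟩⟩⟩
  obtain ⟨⟨i, j⟩, hijK, hmax⟩ := Finset.exists_max_image K (fun p => p.2.val - p.1.val) hK
  obtain ⟨hijs, hc⟩ := mem_filter.1 hijK
  have hM0 : M.1 i j ≠ 0 := mem_support.1 hijs
  have hij : i < j := lt_of_ne_zero hM0
  dsimp only at hc
  rcases hc with ⟨a, ha, haj⟩ | ⟨b, hb, hib⟩
  -- Otherwise `(a, j)`, which is longer than `(i, j)`, would also lie in `K`. Hence adding a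
  -- multiple of row `a` does not touch row `i` beyond column `j`.
  · have hrow : ∀ b, j < b → M.1 a b = 0 := by
      intro b hb
      by_contra hne
      have := hmax (a, j) (mem_filter.2 ⟨mem_support.2 haj, Or.inr ⟨b, hb, hne⟩⟩)
      dsimp only at this
      omega
    set c := -(M.1 i j / M.1 a j) with hc
    obtain ⟨M', hM'⟩ := dualOf_surjective (dualTranslate (elementary a i ha c) 1 (dualOf M))
    have hent : ∀ p q, p < q → M'.1 p q = M.1 p q + if p = i then M.1 a q * c else 0 := by
      intro p q hpq
      rw [← dualOf_elementary_left M ha c hpq, ← dualTranslate_apply, ← hM',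
        dualOf_strictSingle, mul_one]
    refine ⟨M', ⟨_, _, hM'.symm⟩, supportWeight_lt hM0 (i := i) (j := j) ?_
      (({i} : Finset (Fin N)) ×ˢ univ.filter fun q => i < q ∧ q < j) ?_ ?_⟩
    · rw [hent i j hij, if_pos rfl, hc]
      field_simp
      ring
    · rintro ⟨p, q⟩ h1 h2
      dsimp only at h1 h2
      have hpq := lt_of_ne_zero h1
      rw [hent p q hpq, h2, zero_add] at h1
      have hpi : p = i := by
        by_contra h
        rw [if_neg h] at h1
        exact h1 rfl
      subst hpi
      rw [if_pos rfl] at h1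
      simp only [mem_product, mem_singleton, mem_filter, mem_univ, true_and]
      refine ⟨hpq, lt_of_le_of_ne (not_lt.1 fun hjq => h1 ?_) ?_⟩
      · rw [hrow q hjq, zero_mul]
      · rintro rfl
        exact hM0 h2
    · apply sum_two_pow_lt
      · rintro ⟨p, q⟩ h ⟨p', q'⟩ h' heq
        simp only [coe_product, coe_singleton, Set.mem_prod, Set.mem_singleton_iff, mem_coe,
          mem_filter, mem_univ, true_and] at h h' heq
        obtain ⟨rfl, h1, h2⟩ := h
        obtain ⟨rfl, h3, h4⟩ := h'
        rw [Prod.mk.injEq]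
        exact ⟨rfl, Fin.ext (by omega)⟩
      · rintro ⟨p, q⟩ h
        simp only [mem_product, mem_singleton, mem_filter, mem_univ, true_and] at h
        obtain ⟨rfl, h1, h2⟩ := h
        dsimp only
        omega
  · have hcol : ∀ a, a < i → M.1 a b = 0 := by
      intro a ha
      by_contra hne
      have := hmax (i, b) (mem_filter.2 ⟨mem_support.2 hib, Or.inl ⟨a, ha, hne⟩⟩)
      dsimp only at this
      omega
    set c := -(M.1 i j / M.1 i b) with hc
    obtain ⟨M', hM'⟩ := dualOf_surjective (dualTranslate 1 (elementary j b hb c) (dualOf M))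
    have hent : ∀ p q, p < q → M'.1 p q = M.1 p q + if q = j then M.1 p b * c else 0 := by
      intro p q hpq
      rw [← dualOf_elementary_right M hb c hpq, ← dualTranslate_apply, ← hM',
        dualOf_strictSingle, mul_one]
    refine ⟨M', ⟨_, _, hM'.symm⟩, supportWeight_lt hM0 (i := i) (j := j) ?_
      ((univ.filter fun p => i < p ∧ p < j) ×ˢ ({j} : Finset (Fin N))) ?_ ?_⟩
    · rw [hent i j hij, if_pos rfl, hc]
      field_simp
      ring
    · rintro ⟨p, q⟩ h1 h2
      dsimp only at h1 h2
      have hpq := lt_of_ne_zero h1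
      rw [hent p q hpq, h2, zero_add] at h1
      have hqj : q = j := by
        by_contra h
        rw [if_neg h] at h1
        exact h1 rfl
      subst hqj
      rw [if_pos rfl] at h1
      simp only [mem_product, mem_singleton, mem_filter, mem_univ, true_and, and_true]
      refine ⟨lt_of_le_of_ne (not_lt.1 fun hpi => h1 ?_) ?_, hpq⟩
      · rw [hcol p hpi, zero_mul]
      · rintro rfl
        exact hM0 h2
    · apply sum_two_pow_lt
      · rintro ⟨p, q⟩ h ⟨p', q'⟩ h' heq
        simp only [coe_product, coe_singleton, Set.mem_prod, Set.mem_singleton_iff, mem_coe,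
          mem_filter, mem_univ, true_and] at h h' heq
        obtain ⟨⟨h1, h2⟩, rfl⟩ := h
        obtain ⟨⟨h3, h4⟩, rfl⟩ := h'
        rw [Prod.mk.injEq]
        exact ⟨Fin.ext (by omega), rfl⟩
      · rintro ⟨p, q⟩ h
        simp only [mem_product, mem_singleton, mem_filter, mem_univ, true_and] at h
        obtain ⟨⟨h1, h2⟩, rfl⟩ := h
        dsimp only
        omega

theorem exists_isQuasiMonomial_sameOrbit (l : Module.Dual F (strictUpper N F)) :
    ∃ M, IsQuasiMonomial M ∧ SameOrbit l (dualOf M) := by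
  obtain ⟨M₀, rfl⟩ := dualOf_surjective l
  induction h : supportWeight M₀ using Nat.strong_induction_on generalizing M₀ with
  | _ w ih =>
    by_cases hM : IsQuasiMonomial M₀
    · exact ⟨M₀, hM, SameOrbit.refl _⟩
    · obtain ⟨M', h1, h2⟩ := exists_supportWeight_lt hM
      obtain ⟨M, h3, h4⟩ := ih _ (h ▸ h2) M' rfl
      exact ⟨M, h3, h1.trans h4⟩

end NormalForm

/-! ### Irreducible means noncrossing -/

section Criteria

variable {N : ℕ} {F : Type*} [Field F]

/-- No two nonzero entries `(i, k)`, `(j, l)` satisfy `i < j < k < l`. -/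
def IsNoncrossingMatrix (M : strictUpper N F) : Prop :=
  ∀ i j k l, M.1 i k ≠ 0 → M.1 j l ≠ 0 → ¬ (i < j ∧ j < k ∧ k < l)

/-- If `(a, j)` and `(i, b)` cross, the row operation from `a` to `i` and the column operation from
`b` to `j` can both be scaled to add 1 at `(i, j)` and nothing else, so the left and right orbits
meet again. Conversely, a common change at `(i, j)` needs a nonzero entry above it and one to its
right, which cross. -/
theorem IsQuasiMonomial.isNoncrossingMatrix_iff {M : strictUpper N F} (hM : IsQuasiMonomial M) :
    (∀ g h : unitriangular N F, dualTranslate g 1 (dualOf M) = dualTranslate 1 h (dualOf M) →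
      dualTranslate g 1 (dualOf M) = dualOf M) ↔ IsNoncrossingMatrix M := by
  constructor
  · rintro hirr a i j b haj hib ⟨hai, hij, hjb⟩
    have h1 : ∀ (p q : Fin N) (hpq : p < q),
        dualTranslate (elementary a i hai (M.1 a j)⁻¹) 1 (dualOf M) (strictSingle p q hpq 1) =
          M.1 p q + if p = i ∧ q = j then 1 else 0 := by
      intro p q hpq
      rw [dualTranslate_apply, dualOf_elementary_left]
      congr 1
      by_cases hp : p = i
      · by_cases hq : q = j
        · subst hp hq
          simp [haj]
        · have : M.1 a q = 0 := by
            by_contra h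
            exact hq (hM.1 a q j h haj)
          simp [hq, this]
      · simp [hp]
    have h2 : ∀ (p q : Fin N) (hpq : p < q),
        dualTranslate 1 (elementary j b hjb (M.1 i b)⁻¹) (dualOf M) (strictSingle p q hpq 1) =
          M.1 p q + if p = i ∧ q = j then 1 else 0 := by
      intro p q hpq
      rw [dualTranslate_apply, dualOf_elementary_right]
      congr 1
      by_cases hq : q = j
      · by_cases hp : p = i
        · subst hp hq
          simp [hib]
        · have : M.1 p b = 0 := by
            by_contra h
            exact hp (hM.2 p i b h hib)
          simp [hp, this]
      · simp [hq]
    have h3 := hirr _ _ (dual_ext fun p q hpq => (h1 p q hpq).trans (h2 p q hpq).symm)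
    have h4 := DFunLike.congr_fun h3 (strictSingle i j hij 1)
    rw [h1, dualOf_strictSingle] at h4
    simp at h4
  · intro hnc g h hgh
    refine dual_ext fun i j hij => ?_
    have h1 := DFunLike.congr_fun hgh (strictSingle i j hij 1)
    rw [dualTranslate_apply, dualTranslate_apply, dualOf_sandwich_left,
      dualOf_sandwich_right] at h1
    rw [dualTranslate_apply, dualOf_sandwich_left, dualOf_strictSingle, mul_one, add_eq_left]
    by_contra h2
    have h3 := h2
    rw [add_left_cancel h1] at h3
    obtain ⟨a, ha, ha'⟩ := Finset.exists_ne_zero_of_sum_ne_zero h2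
    obtain ⟨b, hb, hb'⟩ := Finset.exists_ne_zero_of_sum_ne_zero h3
    simp only [mem_filter, mem_univ, true_and] at ha hb
    exact hnc a i j b (left_ne_zero_of_mul ha') (left_ne_zero_of_mul hb') ⟨ha, hij, hb⟩

theorem isIrreducibleCharacter_dualOf_iff [Fintype F] {θ : AddChar F ℂ} (hθ : θ ≠ 1)
    {M : strictUpper N F} (hM : IsQuasiMonomial M) :
    IsIrreducibleCharacter (superCharacter θ (dualOf M)) ↔ IsNoncrossingMatrix M :=
  (isIrreducibleCharacter_superCharacter_iff hθ _).trans hM.isNoncrossingMatrix_iff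

end Criteria

/-! ### `C`-invariance means covering every superdiagonal position -/

section Covering

variable {n : ℕ} {F : Type*} [Field F]

/-- Every `k` is the row of a nonzero entry to the right of column `k + 1`, or `k + 1` is the
column of a nonzero entry above row `k`. -/
def IsCoveringMatrix (M : strictUpper (n + 1) F) : Prop :=
  ∀ k : Fin n, (∃ j, k.succ < j ∧ M.1 k.castSucc j ≠ 0) ∨ ∃ i, i < k.castSucc ∧ M.1 i k.succ ≠ 0

theorem superdiagDual_strictSingle (i j : Fin (n + 1)) (hij : i < j) (c : F) :
    superdiagDual (strictSingle i j hij c) = if j.val = i.val + 1 then c else 0 := by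
  change ∑ k : Fin n, Matrix.single i j c k.castSucc k.succ = _
  split_ifs with h
  · rw [Finset.sum_eq_single ⟨i.val, by omega⟩]
    · rw [Matrix.single_apply, if_pos]
      exact ⟨rfl, Fin.ext h⟩
    · intro k _ hk
      rw [Matrix.single_apply, if_neg]
      rintro ⟨h1, -⟩
      exact hk (Fin.ext (congrArg Fin.val h1).symm)
    · simp
  · refine Finset.sum_eq_zero fun k _ => ?_
    rw [Matrix.single_apply, if_neg]
    rintro ⟨h1, h2⟩
    apply h
    rw [h1, h2]
    rfl

/-- At an uncovered position `(k, k + 1)` neither row nor column operations change the entry, so it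
cannot decrease by 1. -/
theorem isCoveringMatrix_of_sameOrbit {M : strictUpper (n + 1) F}
    (h : SameOrbit (dualOf M) (dualOf M - (1 : F) • superdiagDual)) : IsCoveringMatrix M := by
  obtain ⟨g, h, hgh⟩ := h
  have h1 : dualTranslate g 1 (dualOf M) = dualTranslate 1 h⁻¹ (dualOf M) - superdiagDual := by
    have h2 := congrArg (dualTranslate 1 h⁻¹) hgh
    rw [dualTranslate_dualTranslate, mul_one, inv_mul_cancel] at h2
    rw [h2, one_smul]
    conv_rhs => rw [← dualTranslate_superdiagDual 1 h⁻¹]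
    rfl
  intro k
  by_contra hk
  push Not at hk
  obtain ⟨hrow, hcol⟩ := hk
  have hlt : k.castSucc < k.succ := Fin.castSucc_lt_succ
  have h2 := DFunLike.congr_fun h1 (strictSingle _ _ hlt 1)
  rw [LinearMap.sub_apply, dualTranslate_apply, dualTranslate_apply, dualOf_sandwich_left,
    dualOf_sandwich_right, superdiagDual_strictSingle, if_pos (by simp), Finset.sum_eq_zero,
    Finset.sum_eq_zero] at h2
  · exact one_ne_zero (sub_eq_self.1 h2.symm)
  · intro b hb
    rw [hrow b (by simpa using hb), zero_mul]
  · intro a ha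
    rw [hcol a (by simpa using ha), zero_mul]

theorem dualOf_sandwich (M : strictUpper (n + 1) F) (X Y : strictUpper (n + 1) F)
    (E : strictUpper (n + 1) F) :
    dualOf M (sandwich (unitriangularEquiv.symm X) (unitriangularEquiv.symm Y) E) =
      dualOf M E + dualOf M (strictMul X E) + dualOf M (strictMul E Y) +
        dualOf M (strictMul X (strictMul E Y)) := by
  have hX : ∀ Z : strictUpper (n + 1) F, (unitriangularEquiv.symm Z).1.1 = 1 + Z.1 := fun Z => by
    have := congrArg Subtype.val (unitriangularEquiv.apply_symm_apply Z)
    rw [unitriangularEquiv_apply, coe_unitriangularSubOne] at this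
    rw [← this, add_sub_cancel]
  rw [← map_add, ← map_add, ← map_add]
  congr 1
  apply Subtype.ext
  simp only [coe_sandwich, hX, Submodule.coe_add, coe_strictMul]
  noncomm_ring

theorem dualOf_mul_single (M X : strictUpper (n + 1) F) {p q : Fin (n + 1)} (hpq : p < q) :
    dualOf M (strictMul X (strictSingle p q hpq 1)) = ∑ a, M.1 a q * X.1 a p := by
  rw [dualOf_apply]
  refine Finset.sum_congr rfl fun a _ => ?_
  rw [Finset.sum_eq_single q]
  · simp
  · intro b _ hb
    simp [hb]
  · simp

theorem dualOf_single_mul (M Y : strictUpper (n + 1) F) {p q : Fin (n + 1)} (hpq : p < q) :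
    dualOf M (strictMul (strictSingle p q hpq 1) Y) = ∑ b, M.1 p b * Y.1 q b := by
  rw [dualOf_apply, Finset.sum_eq_single p]
  · simp
  · intro a _ ha
    simp [ha]
  · simp

theorem dualOf_mul_single_mul (M X Y : strictUpper (n + 1) F) {p q : Fin (n + 1)} (hpq : p < q) :
    dualOf M (strictMul X (strictMul (strictSingle p q hpq 1) Y)) =
      ∑ a, ∑ b, M.1 a b * (X.1 a p * Y.1 q b) := by
  rw [dualOf_apply]
  refine Finset.sum_congr rfl fun a _ => Finset.sum_congr rfl fun b _ => ?_
  rw [coe_strictMul, coe_strictMul, coe_strictSingle, Matrix.mul_apply, Finset.sum_eq_single p]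
  · simp
  · intro c _ hc
    simp [hc]
  · simp

/-- An arc `(a, p + 1)` with `a < p` can put `-t` at `(p, p + 1)` by a row operation, and an arc
`(p, b)` with `p + 1 < b` by a column operation. All these operations are done at once, and
noncrossing ensures that each position is hit only once. -/
theorem IsQuasiMonomial.sameOrbit_sub_superdiagDual {M : strictUpper (n + 1) F}
    (hM : IsQuasiMonomial M) (hnc : IsNoncrossingMatrix M) (hcov : IsCoveringMatrix M) (t : F) :
    SameOrbit (dualOf M) (dualOf M - t • superdiagDual) := by
  -- Where there is no arc, the inverse of zero is zero. Wrap-around is harmless: `p + 1` at the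
  -- last vertex reads column 0 and `q - 1` at the first reads the last row, both zero in `M`.
  let X : strictUpper (n + 1) F :=
    ⟨fun a p => if a < p then -t * (M.1 a (p + 1))⁻¹ else 0, fun a p h => if_neg h.not_gt⟩
  let Y : strictUpper (n + 1) F :=
    ⟨fun q b => if q < b then -t * (M.1 (q - 1) b)⁻¹ else 0, fun a p h => if_neg h.not_gt⟩
  have hXv : ∀ a p, X.1 a p ≠ 0 → a < p ∧ M.1 a (p + 1) ≠ 0 ∧ (p + 1).val = p.val + 1 := by
    intro a p h
    change (if a < p then -t * (M.1 a (p + 1))⁻¹ else 0) ≠ 0 at h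
    split_ifs at h with hap
    · have h1 : M.1 a (p + 1) ≠ 0 := by
        intro h0
        simp [h0] at h
      refine ⟨hap, h1, ?_⟩
      rw [Fin.val_add_one, if_neg]
      rintro rfl
      rw [Fin.last_add_one] at h1
      exact h1 (M.2 _ _ (Fin.zero_le a))
    · exact absurd rfl h
  have hYv : ∀ q b, Y.1 q b ≠ 0 → q < b ∧ M.1 (q - 1) b ≠ 0 ∧ q.val = (q - 1).val + 1 := by
    intro q b h
    change (if q < b then -t * (M.1 (q - 1) b)⁻¹ else 0) ≠ 0 at h
    split_ifs at h with hap
    · have h1 : M.1 (q - 1) b ≠ 0 := by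
        intro h0
        simp [h0] at h
      refine ⟨hap, h1, ?_⟩
      have hq : q ≠ 0 := by
        rintro rfl
        have h2 : (0 : Fin (n + 1)) - 1 = Fin.last n := by
          rw [sub_eq_iff_eq_add, Fin.last_add_one]
        rw [h2] at h1
        exact h1 (M.2 _ _ (Fin.le_last b))
      have h3 := Fin.val_sub_one_of_ne_zero hq
      have h4 : q.val ≠ 0 := fun h => hq (Fin.ext h)
      omega
    · exact absurd rfl h
  refine ⟨unitriangularEquiv.symm X, unitriangularEquiv.symm Y, dual_ext fun p q hpq => ?_⟩
  rw [dualTranslate_apply, dualOf_sandwich, LinearMap.sub_apply, LinearMap.smul_apply,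
    superdiagDual_strictSingle, dualOf_mul_single, dualOf_single_mul, dualOf_mul_single_mul,
    Finset.sum_eq_zero (f := fun a => ∑ b, M.1 a b * (X.1 a p * Y.1 q b)), add_zero, add_assoc,
    sub_eq_add_neg, add_right_inj]
  -- A surviving mixed term would have `b = p + 1` by uniqueness in row `a`, leaving no room for `p
  -- < q < b`.
  swap
  · intro a _
    refine Finset.sum_eq_zero fun b _ => ?_
    by_contra h
    have hm := left_ne_zero_of_mul h
    have hx := hXv _ _ (left_ne_zero_of_mul (right_ne_zero_of_mul h))
    have hy := hYv _ _ (right_ne_zero_of_mul (right_ne_zero_of_mul h))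
    have hb := hM.1 a b (p + 1) hm hx.2.1
    have h1 := hx.2.2
    have h2 := hy.1
    rw [← hb] at h1
    omega
  by_cases hq : q.val = p.val + 1
  · obtain ⟨k, rfl⟩ : ∃ k : Fin n, p = k.castSucc := ⟨⟨p.val, by omega⟩, rfl⟩
    obtain rfl : q = k.succ := Fin.ext hq
    rw [if_pos hq]
    have hk1 : k.castSucc + 1 = k.succ := Fin.coeSucc_eq_succ
    have hk2 : k.succ - 1 = k.castSucc := by rw [sub_eq_iff_eq_add, hk1]
    have hXe : ∀ a, a < k.castSucc → X.1 a k.castSucc = -t * (M.1 a k.succ)⁻¹ := fun a ha => by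
      change (if a < k.castSucc then -t * (M.1 a (k.castSucc + 1))⁻¹ else 0) = _
      rw [if_pos ha, hk1]
    have hYe : ∀ b, k.succ < b → Y.1 k.succ b = -t * (M.1 k.castSucc b)⁻¹ := fun b hb => by
      change (if k.succ < b then -t * (M.1 (k.succ - 1) b)⁻¹ else 0) = _
      rw [if_pos hb, hk2]
    -- Noncrossing makes the alternatives exclusive: arcs `(i, k + 1)` and `(k, j)` with `i < k` and
    -- `k + 1 < j` cross. So one sum is empty and the other has a single term.
    rcases hcov k with ⟨j, hj, hkj⟩ | ⟨i, hi, hik⟩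
    · rw [Finset.sum_eq_zero, Finset.sum_eq_single j, hYe j hj]
      · simp only [smul_eq_mul]
        field_simp
        ring
      · intro b _ hb
        by_contra h
        exact hb (hM.1 _ _ _ (left_ne_zero_of_mul h) hkj)
      · simp
      · intro a _
        by_contra h
        have h1 := hXv _ _ (right_ne_zero_of_mul h)
        exact hnc _ _ _ _ (left_ne_zero_of_mul h) hkj ⟨h1.1, hpq, hj⟩
    · rw [Finset.sum_eq_single i, Finset.sum_eq_zero, hXe i hi]
      · simp only [smul_eq_mul]
        field_simp
        ring
      · intro b _
        by_contra h
        have h1 := hYv _ _ (right_ne_zero_of_mul h)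
        exact hnc _ _ _ _ hik (left_ne_zero_of_mul h) ⟨hi, hpq, h1.1⟩
      · intro b _ hb
        by_contra h
        exact hb (hM.2 _ _ _ (left_ne_zero_of_mul h) hik)
      · simp
  -- Uniqueness in rows and columns confines the effect of each operation to the superdiagonal.
  · rw [if_neg hq, Finset.sum_eq_zero, Finset.sum_eq_zero]
    · simp
    · intro b _
      by_contra h
      have h1 := hYv _ _ (right_ne_zero_of_mul h)
      have h2 := hM.2 _ _ _ (left_ne_zero_of_mul h) h1.2.1
      rw [← h2] at h1
      exact hq h1.2.2
    · intro a _
      by_contra h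
      have h1 := hXv _ _ (right_ne_zero_of_mul h)
      have h2 := hM.1 _ _ _ (left_ne_zero_of_mul h) h1.2.1
      rw [← h2] at h1
      exact hq h1.2.2

theorem isCInvariant_dualOf_iff [Fintype F] {θ : AddChar F ℂ} (hθ : θ ≠ 1)
    {M : strictUpper (n + 1) F} (hM : IsQuasiMonomial M) (hnc : IsNoncrossingMatrix M) :
    IsCInvariant (superCharacter θ (dualOf M)) ↔ IsCoveringMatrix M := by
  rw [isCInvariant_superCharacter_iff hθ]
  exact ⟨fun h => isCoveringMatrix_of_sameOrbit (h 1),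
    fun h t => hM.sameOrbit_sub_superdiagDual hnc h t⟩

end Covering

/-! ### Heisenberg characters and the lower central series -/

section Heisenberg

open scoped commutatorElement

variable {N : ℕ} {F : Type*} [Field F]

/-- The vanishing of the entries `A_{ij}` with `j < i + m`. -/
def VanishesBelow (m : ℕ) (A : Matrix (Fin N) (Fin N) F) : Prop :=
  ∀ i j : Fin N, j.val < i.val + m → A i j = 0

theorem VanishesBelow.mul {m m' : ℕ} {A B : Matrix (Fin N) (Fin N) F} (hA : VanishesBelow m A)
    (hB : VanishesBelow m' B) : VanishesBelow (m + m') (A * B) := by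
  intro i j hij
  rw [Matrix.mul_apply]
  refine Finset.sum_eq_zero fun k _ => ?_
  rcases lt_or_ge k.val (i.val + m) with hk | hk
  · rw [hA i k hk, zero_mul]
  · rw [hB k j (by omega), mul_zero]

theorem VanishesBelow.add {m : ℕ} {A B : Matrix (Fin N) (Fin N) F} (hA : VanishesBelow m A)
    (hB : VanishesBelow m B) : VanishesBelow m (A + B) := fun i j h => by
  rw [Matrix.add_apply, hA i j h, hB i j h, add_zero]

theorem VanishesBelow.neg {m : ℕ} {A : Matrix (Fin N) (Fin N) F} (hA : VanishesBelow m A) :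
    VanishesBelow m (-A) := fun i j h => by
  rw [Matrix.neg_apply, hA i j h, neg_zero]

theorem vanishesBelow_unitriangular (g : unitriangular N F) : VanishesBelow 0 g.1.1 :=
  fun i j h => g.2.1 i j h

theorem vanishesBelow_subOne (g : unitriangular N F) : VanishesBelow 1 (g.1.1 - 1) :=
  fun i j h => (unitriangularSubOne g).2 i j (Nat.lt_succ_iff.1 h)

/-- The subgroup of the `g` such that `g - 1` vanishes below the `m`-th superdiagonal. -/
def superdiagSubgroup (m : ℕ) : Subgroup (unitriangular N F) where
  carrier := {g | VanishesBelow m (g.1.1 - 1)}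
  one_mem' := fun i j _ => by simp
  mul_mem' {g h} hg hh := by
    have h1 : (g * h).1.1 - 1 = (g.1.1 - 1) * h.1.1 + (h.1.1 - 1) := by
      simp [sub_mul]
    change VanishesBelow m _
    rw [h1]
    exact (hg.mul (vanishesBelow_unitriangular h)).add hh
  inv_mem' {g} hg := by
    have h1 : (g⁻¹).1.1 - 1 = -((g⁻¹).1.1 * (g.1.1 - 1)) := by
      simp [mul_sub]
    change VanishesBelow m _
    rw [h1]
    have h2 := (vanishesBelow_unitriangular g⁻¹).mul hg
    rw [zero_add] at h2
    exact h2.neg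

/-- `⁅g, h⁆ - 1 = (gh - hg) g⁻¹h⁻¹`, and `gh - hg` is the additive commutator of `g - 1` and `h -
1`, which lies one superdiagonal further out. -/
theorem commutator_le_superdiagSubgroup (m : ℕ) (H : Subgroup (unitriangular N F))
    (hH : H ≤ superdiagSubgroup m) : ⁅(⊤ : Subgroup (unitriangular N F)), H⁆ ≤
      superdiagSubgroup (m + 1) := by
  rw [Subgroup.commutator_le]
  intro g _ h hh
  have h1 : (⁅g, h⁆).1.1 - 1 = ((g.1.1 - 1) * (h.1.1 - 1) + -((h.1.1 - 1) * (g.1.1 - 1))) *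
      (g⁻¹ * h⁻¹).1.1 := by
    have h2 : (g.1.1 - 1) * (h.1.1 - 1) + -((h.1.1 - 1) * (g.1.1 - 1)) =
        (g * h).1.1 - (h * g).1.1 := by
      simp only [Subgroup.coe_mul, Units.val_mul]
      noncomm_ring
    rw [h2, sub_mul, commutatorElement_def]
    congr 1
    · simp only [Subgroup.coe_mul, Units.val_mul, mul_assoc]
    · rw [← Units.val_mul, ← Subgroup.coe_mul]
      simp [mul_assoc]
  change VanishesBelow (m + 1) _
  rw [h1]
  have hh' : VanishesBelow m (h.1.1 - 1) := hH hh
  have h3 := (vanishesBelow_subOne g).mul hh'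
  rw [add_comm] at h3
  exact (h3.add ((hh'.mul (vanishesBelow_subOne g)).neg)).mul (vanishesBelow_unitriangular _)

theorem commutator_commutator_le_superdiagSubgroup :
    ⁅(⊤ : Subgroup (unitriangular N F)), ⁅(⊤ : Subgroup (unitriangular N F)),
      (⊤ : Subgroup (unitriangular N F))⁆⁆ ≤ superdiagSubgroup 3 :=
  commutator_le_superdiagSubgroup 2 _
    (commutator_le_superdiagSubgroup 1 _ fun g _ => vanishesBelow_subOne g)

theorem commutator_elementary {i j k : Fin N} (hij : i < j) (hjk : j < k) (c : F) :
    ⁅elementary i j hij (1 : F), elementary j k hjk c⁆ = elementary i k (hij.trans hjk) c := by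
  rw [commutatorElement_def, mul_inv_eq_iff_eq_mul, mul_inv_eq_iff_eq_mul]
  apply Subtype.ext
  apply Units.ext
  have h1 : k ≠ i := (hij.trans hjk).ne'
  simp [coe_elementary, add_mul, mul_add, Matrix.single_mul_single_of_ne, h1, hjk.ne']
  abel

/-- Factor the arc through `i + 1` and `i + 2` as a double commutator; length at least 3 leaves room
for both. -/
theorem elementary_mem_commutator_commutator {i l : Fin N} (hil : i.val + 3 ≤ l.val) (c : F) :
    elementary i l (Fin.lt_def.2 (by omega)) c ∈ ⁅(⊤ : Subgroup (unitriangular N F)),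
      ⁅(⊤ : Subgroup (unitriangular N F)), (⊤ : Subgroup (unitriangular N F))⁆⁆ := by
  have h1 : i < (⟨i.val + 1, by omega⟩ : Fin N) := Fin.lt_def.2 (by simp)
  have h2 : (⟨i.val + 1, by omega⟩ : Fin N) < (⟨i.val + 2, by omega⟩ : Fin N) :=
    Fin.lt_def.2 (by simp)
  have h3 : (⟨i.val + 2, by omega⟩ : Fin N) < l := Fin.lt_def.2 (by simp; omega)
  rw [← commutator_elementary h1 (h2.trans h3), ← commutator_elementary h2 h3]
  exact Subgroup.commutator_mem_commutator (Subgroup.mem_top _)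
    (Subgroup.commutator_mem_commutator (Subgroup.mem_top _) (Subgroup.mem_top _))

/-- A longer arc is seen by an elementary matrix at its position, lying in the double commutator.
Conversely, that subgroup lives on the third superdiagonal and beyond, where a matrix with only
short arcs pairs to zero. -/
theorem isHeisenbergCharacter_dualOf_iff [Fintype F] {θ : AddChar F ℂ} (hθ : θ ≠ 1)
    {M : strictUpper N F} (hM : IsQuasiMonomial M) :
    IsHeisenbergCharacter (superCharacter θ (dualOf M)) ↔
      IsNoncrossingMatrix M ∧ ∀ i j, M.1 i j ≠ 0 → j.val ≤ i.val + 2 := by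
  rw [IsHeisenbergCharacter, isIrreducibleCharacter_dualOf_iff hθ hM]
  refine and_congr_right fun _ => ⟨fun h i j hij => ?_, fun h g hg => ?_⟩
  · by_contra hlt
    have hlt' : i.val + 3 ≤ j.val := by omega
    obtain ⟨c, hc⟩ := exists_apply_mul_ne_one hθ hij
    apply hc
    have h1 := apply_eq_one_of_superCharacter_eq hθ
      (h _ (elementary_mem_commutator_commutator hlt' c))
    rwa [unitriangularSubOne_elementary, dualOf_strictSingle, mul_comm] at h1
  · refine superCharacter_eq_one_of_forall hθ fun a b => ?_
    have hg' : VanishesBelow 3 (g.1.1 - 1) := commutator_commutator_le_superdiagSubgroup hg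
    have h1 := ((vanishesBelow_unitriangular a).mul hg').mul (vanishesBelow_unitriangular b)
    rw [dualOf_apply]
    refine Finset.sum_eq_zero fun i _ => Finset.sum_eq_zero fun j _ => ?_
    by_cases hij : M.1 i j = 0
    · rw [hij, zero_mul]
    · have h2 := h i j hij
      rw [coe_sandwich, coe_unitriangularSubOne, h1 i j (by omega), mul_zero]

end Heisenberg

/-! ### Splitting noncrossing arc sets at the least point -/

section ArcSets

/-- The set of arcs of a noncrossing partition of the interval `[a, b)`. -/
structure IsArcSet (a b : ℕ) (A : Finset (ℕ × ℕ)) : Prop where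
  bounds : ∀ p ∈ A, a ≤ p.1 ∧ p.1 < p.2 ∧ p.2 < b
  left_unique : ∀ p ∈ A, ∀ q ∈ A, p.1 = q.1 → p = q
  right_unique : ∀ p ∈ A, ∀ q ∈ A, p.2 = q.2 → p = q
  noncrossing : ∀ p ∈ A, ∀ q ∈ A, ¬ (p.1 < q.1 ∧ q.1 < p.2 ∧ p.2 < q.2)

open Classical in
/-- The noncrossing arc sets on the interval `[a, b)`. -/
noncomputable def arcSets (a b : ℕ) : Finset (Finset (ℕ × ℕ)) :=
  ((range b ×ˢ range b).powerset).filter (IsArcSet a b)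

theorem mem_arcSets {a b : ℕ} {A : Finset (ℕ × ℕ)} : A ∈ arcSets a b ↔ IsArcSet a b A := by
  classical
  rw [arcSets, mem_filter, mem_powerset, and_iff_right_iff_imp]
  intro h p hp
  have := h.bounds p hp
  rw [mem_product, mem_range, mem_range]
  omega

theorem arcSets_eq_singleton {a b : ℕ} (h : b ≤ a + 1) : arcSets a b = {∅} := by
  ext A
  rw [mem_arcSets, mem_singleton]
  constructor
  · intro hA
    rw [Finset.eq_empty_iff_forall_notMem]
    intro p hp
    have := hA.bounds p hp
    omega
  · rintro rfl
    constructor <;> simp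

theorem IsArcSet.join {a k b : ℕ} (hak : a < k) (hkb : k < b) {B C : Finset (ℕ × ℕ)}
    (hB : IsArcSet (a + 1) k B) (hC : IsArcSet k b C) :
    IsArcSet a b (insert (a, k) (B ∪ C)) := by
  have hmem : ∀ p ∈ insert (a, k) (B ∪ C), p = (a, k) ∨ p ∈ B ∨ p ∈ C := fun p hp => by
    simpa using hp
  constructor
  · intro p hp
    rcases hmem p hp with rfl | hp | hp
    · exact ⟨le_rfl, hak, hkb⟩
    · have := hB.bounds p hp
      omega
    · have := hC.bounds p hp
      omega
  · intro p hp q hq h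
    rcases hmem p hp with rfl | hp | hp <;> rcases hmem q hq with rfl | hq | hq
    · rfl
    · have := hB.bounds q hq; omega
    · have := hC.bounds q hq; omega
    · have := hB.bounds p hp; omega
    · exact hB.left_unique p hp q hq h
    · have := hB.bounds p hp; have := hC.bounds q hq; omega
    · have := hC.bounds p hp; omega
    · have := hC.bounds p hp; have := hB.bounds q hq; omega
    · exact hC.left_unique p hp q hq h
  · intro p hp q hq h
    rcases hmem p hp with rfl | hp | hp <;> rcases hmem q hq with rfl | hq | hq
    · rfl
    · have := hB.bounds q hq; omega
    · have := hC.bounds q hq; omega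
    · have := hB.bounds p hp; omega
    · exact hB.right_unique p hp q hq h
    · have := hB.bounds p hp; have := hC.bounds q hq; omega
    · have := hC.bounds p hp; omega
    · have := hC.bounds p hp; have := hB.bounds q hq; omega
    · exact hC.right_unique p hp q hq h
  · intro p hp q hq h
    rcases hmem p hp with rfl | hp | hp <;> rcases hmem q hq with rfl | hq | hq
    · omega
    · have := hB.bounds q hq; omega
    · have := hC.bounds q hq; omega
    · have := hB.bounds p hp; omega
    · exact hB.noncrossing p hp q hq h
    · have := hB.bounds p hp; have := hC.bounds q hq; omega
    · have := hC.bounds p hp; omega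
    · have := hC.bounds p hp; have := hB.bounds q hq; omega
    · exact hC.noncrossing p hp q hq h

theorem IsArcSet.mono {a b a' b' : ℕ} {A B : Finset (ℕ × ℕ)} (hA : IsArcSet a b A) (hBA : B ⊆ A)
    (hB : ∀ p ∈ B, a' ≤ p.1 ∧ p.1 < p.2 ∧ p.2 < b') : IsArcSet a' b' B where
  bounds := hB
  left_unique p hp q hq := hA.left_unique p (hBA hp) q (hBA hq)
  right_unique p hp q hq := hA.right_unique p (hBA hp) q (hBA hq)
  noncrossing p hp q hq := hA.noncrossing p (hBA hp) q (hBA hq)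

theorem filter_join_left {a k b : ℕ} {B C : Finset (ℕ × ℕ)}
    (hB : IsArcSet (a + 1) k B) (hC : IsArcSet k b C) :
    (insert (a, k) (B ∪ C)).filter (fun p => p.2 < k) = B := by
  ext p
  rw [mem_filter, mem_insert, mem_union]
  constructor
  · rintro ⟨rfl | hp | hp, h⟩
    · exact absurd h (lt_irrefl _)
    · exact hp
    · have := hC.bounds p hp
      omega
  · intro hp
    exact ⟨Or.inr (Or.inl hp), (hB.bounds p hp).2.2⟩

theorem filter_join_right {a k b : ℕ} (hak : a < k) {B C : Finset (ℕ × ℕ)}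
    (hB : IsArcSet (a + 1) k B) (hC : IsArcSet k b C) :
    (insert (a, k) (B ∪ C)).filter (fun p => k ≤ p.1) = C := by
  ext p
  rw [mem_filter, mem_insert, mem_union]
  constructor
  · rintro ⟨rfl | hp | hp, h⟩
    · exact absurd hak h.not_gt
    · have := hB.bounds p hp
      omega
    · exact hp
  · intro hp
    exact ⟨Or.inr (Or.inr hp), (hC.bounds p hp).1⟩

theorem card_join {a k b : ℕ} (hak : a < k) {B C : Finset (ℕ × ℕ)}
    (hB : IsArcSet (a + 1) k B) (hC : IsArcSet k b C) :
    #(insert (a, k) (B ∪ C)) = #B + #C + 1 := by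
  rw [card_insert_of_notMem, card_union_of_disjoint]
  · rw [Finset.disjoint_left]
    intro p hp hp'
    have := hB.bounds p hp
    have := hC.bounds p hp'
    omega
  · rw [mem_union]
    rintro (h | h)
    · have := hB.bounds _ h
      omega
    · have := hC.bounds _ h
      omega

/-- Either no arc leaves `a`, or exactly one arc `(a, k)` does, and then every other arc lies inside
`[a + 1, k)` or inside `[k, b)`. -/
theorem sum_arcSets {R : Type*} [AddCommMonoid R] {a b : ℕ} (hab : a < b)
    (f : Finset (ℕ × ℕ) → R) :
    ∑ A ∈ arcSets a b, f A = ∑ A ∈ arcSets (a + 1) b, f A +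
      ∑ k ∈ Ioo a b, ∑ B ∈ arcSets (a + 1) k, ∑ C ∈ arcSets k b,
        f (insert (a, k) (B ∪ C)) := by
  classical
  rw [← Finset.sum_filter_not_add_sum_filter (arcSets a b) (fun A => ∃ k, (a, k) ∈ A)]
  congr 1
  · congr 1
    ext A
    rw [mem_filter, mem_arcSets, mem_arcSets]
    constructor
    · rintro ⟨hA, hn⟩
      refine hA.mono (Subset.refl _) fun p hp => ?_
      have h1 := hA.bounds p hp
      have h2 : p.1 ≠ a := by
        rintro rfl
        exact hn ⟨p.2, hp⟩
      omega
    · intro hA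
      refine ⟨hA.mono (Subset.refl _) fun p hp => ?_, ?_⟩
      · have h1 := hA.bounds p hp
        omega
      · rintro ⟨k, hk⟩
        have := hA.bounds _ hk
        omega
  · simp_rw [← Finset.sum_product' (arcSets (a + 1) _)]
    rw [Finset.sum_sigma']
    symm
    refine Finset.sum_bij
      (fun (x : (_ : ℕ) × Finset (ℕ × ℕ) × Finset (ℕ × ℕ)) _ =>
        insert (a, x.1) (x.2.1 ∪ x.2.2)) ?_ ?_ ?_ ?_
    · rintro ⟨k, B, C⟩ h
      simp only [mem_sigma, mem_Ioo, mem_product, mem_arcSets, mem_filter] at h ⊢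
      exact ⟨h.2.1.join h.1.1 h.1.2 h.2.2, k, mem_insert_self _ _⟩
    · rintro ⟨k, B, C⟩ h ⟨k', B', C'⟩ h' heq
      simp only [mem_sigma, mem_Ioo, mem_product, mem_arcSets] at h h' heq
      have hk : k = k' := by
        have h1 : (a, k) ∈ insert (a, k') (B' ∪ C') := heq ▸ mem_insert_self _ _
        exact congrArg Prod.snd ((h'.2.1.join h'.1.1 h'.1.2 h'.2.2).left_unique _ h1 _
          (mem_insert_self _ _) rfl)
      subst hk
      have hB := filter_join_left h.2.1 h.2.2
      have hC := filter_join_right h.1.1 h.2.1 h.2.2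
      rw [heq, filter_join_left h'.2.1 h'.2.2] at hB
      rw [heq, filter_join_right h'.1.1 h'.2.1 h'.2.2] at hC
      rw [hB, hC]
    · intro A hA
      rw [mem_filter, mem_arcSets] at hA
      obtain ⟨hA, k, hk⟩ := hA
      have hkb := hA.bounds _ hk
      dsimp only at hkb
      -- The clause `p.1 ≠ a` follows from `p.2 < k` by uniqueness at `a`; stating it makes the
      -- bounds immediate.
      refine ⟨⟨k, A.filter (fun p => p.2 < k ∧ p.1 ≠ a), A.filter (fun p => k ≤ p.1)⟩, ?_, ?_⟩
      · simp only [mem_sigma, mem_Ioo, mem_product, mem_arcSets]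
        refine ⟨hkb.2, hA.mono (filter_subset _ _) fun p hp => ?_,
          hA.mono (filter_subset _ _) fun p hp => ?_⟩
        · rw [mem_filter] at hp
          have := hA.bounds p hp.1
          omega
        · rw [mem_filter] at hp
          have := hA.bounds p hp.1
          omega
      · ext p
        simp only [mem_insert, mem_union, mem_filter]
        constructor
        · rintro (rfl | hp | hp)
          · exact hk
          · exact hp.1
          · exact hp.1
        · intro hp
          by_cases h1 : p = (a, k)
          · exact Or.inl h1
          · right
            have h2 : p.1 ≠ a := fun h => h1 (hA.left_unique p hp _ hk h)
            have h3 : p.2 ≠ k := fun h => h1 (hA.right_unique p hp _ hk h)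
            -- An arc starting strictly under `(a, k)` cannot end beyond `k`.
            have h4 := hA.noncrossing _ hk p hp
            have h5 := hA.bounds p hp
            dsimp only at h4
            by_cases h6 : k ≤ p.1
            · exact Or.inr ⟨hp, h6⟩
            · refine Or.inl ⟨hp, ?_, h2⟩
              omega
    · intro _ _
      rfl

end ArcSets

/-! ### Catalan recurrences -/

section Recursions

/-- The sequence `1, 1, 0, y, 0, 2 y², 0, 5 y³, …` of interleaved Catalan numbers. -/
def interleavedCatalan (y : ℤ) (m : ℕ) : ℤ :=
  if m = 0 then 1 else if Even m then 0 else y ^ (m / 2) * catalan (m / 2)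

theorem interleavedCatalan_odd (y : ℤ) (r : ℕ) :
    interleavedCatalan y (2 * r + 1) = y ^ r * catalan r := by
  have h : (2 * r + 1) / 2 = r := by omega
  rw [interleavedCatalan, if_neg (by omega), if_neg (by simp), h]

theorem interleavedCatalan_even (y : ℤ) {m : ℕ} (hm : m ≠ 0) (h : Even m) :
    interleavedCatalan y m = 0 := by
  rw [interleavedCatalan, if_neg hm, if_pos h]

/-- For even `m`, each product has a factor of positive even index, which vanishes; for odd `m`, the
terms with even `j` form the Catalan convolution. -/
theorem interleavedCatalan_add_two (y : ℤ) (m : ℕ) :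
    interleavedCatalan y (m + 2) = y * ∑ j ∈ range m,
      interleavedCatalan y (j + 1) * interleavedCatalan y (m - j) := by
  rcases Nat.even_or_odd' m with ⟨r, rfl | rfl⟩
  · rw [interleavedCatalan_even y (by omega) (by simp [parity_simps]), Finset.sum_eq_zero, mul_zero]
    intro j hj
    rw [mem_range] at hj
    rcases Nat.even_or_odd j with h | h
    · rw [interleavedCatalan_even y (m := 2 * r - j) (by omega)
        ((Nat.even_sub hj.le).2 (by simp [h])), mul_zero]
    · rw [interleavedCatalan_even y (m := j + 1) (by omega) h.add_one, zero_mul]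
  · rw [show 2 * r + 1 + 2 = 2 * (r + 1) + 1 by ring, interleavedCatalan_odd, catalan_succ,
      Fin.sum_univ_eq_sum_range (fun i => catalan i * catalan (r - i)) (r + 1), pow_succ,
      mul_comm (y ^ r), mul_assoc]
    congr 1
    push_cast
    rw [Finset.mul_sum]
    refine Finset.sum_of_injOn (fun i => 2 * i) ?_ ?_ ?_ ?_
    · intro i _ j _ h
      dsimp only at h
      omega
    · intro i hi
      simp only [coe_range, Set.mem_Iio] at hi ⊢
      omega
    · intro j hj hj'
      rcases Nat.even_or_odd' j with ⟨i, rfl | rfl⟩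
      · rw [mem_range] at hj
        exact absurd ⟨i, by simp; omega, rfl⟩ hj'
      · rw [interleavedCatalan_even y (m := 2 * i + 1 + 1) (by omega) (by simp [parity_simps]),
          zero_mul]
    · intro i hi
      rw [mem_range] at hi
      rw [show 2 * r + 1 - 2 * i = 2 * (r - i) + 1 by omega, interleavedCatalan_odd,
        interleavedCatalan_odd]
      have h : y ^ r = y ^ i * y ^ (r - i) := by rw [← pow_add]; congr 1; omega
      rw [h]
      ring

theorem sum_Ioo_eq_sum_range (a b : ℕ) (f : ℕ → ℤ) :
    ∑ k ∈ Ioo a b, f k = ∑ j ∈ range (b - (a + 1)), f (a + 1 + j) := by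
  rw [← Finset.sum_Ico_eq_sum_range]
  rfl

theorem sum_neg_one_pow_arcSets (m : ℕ) : ∀ a,
    ∑ A ∈ arcSets a (a + m), (-1 : ℤ) ^ #A = interleavedCatalan (-1) m := by
  induction m using Nat.strong_induction_on with
  | _ m ih =>
    intro a
    match m with
    | 0 => simp [arcSets_eq_singleton, interleavedCatalan]
    | 1 => simp [arcSets_eq_singleton, interleavedCatalan]
    | m + 2 =>
      have h1 : ∀ k ∈ Ioo a (a + (m + 2)), ∑ B ∈ arcSets (a + 1) k,
          ∑ C ∈ arcSets k (a + (m + 2)), (-1 : ℤ) ^ #(insert (a, k) (B ∪ C)) =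
          -(interleavedCatalan (-1) (k - (a + 1)) *
            interleavedCatalan (-1) (a + (m + 2) - k)) := by
        intro k hk
        rw [mem_Ioo] at hk
        have hB := ih (k - (a + 1)) (by omega) (a + 1)
        have hC := ih (a + (m + 2) - k) (by omega) k
        rw [Nat.add_sub_cancel' (by omega)] at hB hC
        rw [← hB, ← hC, Finset.sum_mul_sum, ← Finset.sum_neg_distrib]
        refine Finset.sum_congr rfl fun B hB => ?_
        rw [← Finset.sum_neg_distrib]
        refine Finset.sum_congr rfl fun C hC => ?_
        rw [card_join hk.1 (mem_arcSets.1 hB) (mem_arcSets.1 hC)]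
        ring
      have h2 := ih (m + 1) (by omega) (a + 1)
      rw [show a + 1 + (m + 1) = a + (m + 2) by ring] at h2
      rw [sum_arcSets (by omega), Finset.sum_congr rfl h1, h2, sum_Ioo_eq_sum_range,
        show a + (m + 2) - (a + 1) = m + 1 by omega, Finset.sum_range_succ',
        interleavedCatalan_add_two]
      -- The term of the arc `(a, a + 1)` cancels the arc sets with no arc at `a`; this uses the
      -- value 1 at the empty interval.
      have h3 : a + (m + 2) - (a + 1 + 0) = m + 1 := by omega
      have h4 : interleavedCatalan (-1) 0 = 1 := rfl
      rw [h3, add_zero, Nat.sub_self, h4, neg_mul, one_mul, one_mul, ← Finset.sum_neg_distrib,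
        add_comm (∑ j ∈ range m, _), add_neg_cancel_left]
      refine Finset.sum_congr rfl fun j hj => ?_
      rw [mem_range] at hj
      congr 3 <;> omega

/-- Every `g` with `g, g + 1` in `[a, b)` is the left end of an arc ending after `g + 1`, or
`g + 1` is the right end of an arc starting before `g`; all lengths of arcs satisfy `Q`. -/
structure IsCoveringArcSet (Q : ℕ → Prop) (a b : ℕ) (A : Finset (ℕ × ℕ)) : Prop where
  cover : ∀ g, a ≤ g → g + 1 < b →
    (∃ j, g + 1 < j ∧ (g, j) ∈ A) ∨ ∃ i, i < g ∧ (i, g + 1) ∈ A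
  length : ∀ p ∈ A, Q (p.2 - p.1)

theorem isCoveringArcSet_iff {Q : ℕ → Prop} {a b : ℕ} {A : Finset (ℕ × ℕ)} :
    IsCoveringArcSet Q a b A ↔ (∀ g, a ≤ g → g + 1 < b →
      (∃ j, g + 1 < j ∧ (g, j) ∈ A) ∨ ∃ i, i < g ∧ (i, g + 1) ∈ A) ∧ ∀ p ∈ A, Q (p.2 - p.1) :=
  ⟨fun h => ⟨h.cover, h.length⟩, fun h => ⟨h.1, h.2⟩⟩

/-- Nothing starts before `a`, so the gap at `a` must be covered by `(a, k)` itself, whence `a + 1 <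
k`. The same arc covers the gap ending at `k`, and every other gap belongs to one side. -/
theorem isCoveringArcSet_join {Q : ℕ → Prop} {a k b : ℕ} (hak : a < k) (hkb : k < b)
    {B C : Finset (ℕ × ℕ)} (hB : IsArcSet (a + 1) k B) (hC : IsArcSet k b C) :
    IsCoveringArcSet Q a b (insert (a, k) (B ∪ C)) ↔
      (a + 1 < k ∧ Q (k - a)) ∧ IsCoveringArcSet Q (a + 1) k B ∧ IsCoveringArcSet Q k b C := by
  simp only [isCoveringArcSet_iff, mem_insert, mem_union, Prod.mk.injEq]
  constructor
  · rintro ⟨hc, hl⟩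
    refine ⟨⟨?_, hl (a, k) (Or.inl rfl)⟩, ⟨fun g hg hg' => ?_, fun p hp => hl p (by tauto)⟩,
      fun g hg hg' => ?_, fun p hp => hl p (by tauto)⟩
    · rcases hc a le_rfl (by omega) with ⟨j, hj, h | h | h⟩ | ⟨i, hi, h | h | h⟩
      · omega
      · have := hB.bounds _ h; omega
      · have := hC.bounds _ h; omega
      · omega
      · have := hB.bounds _ h; omega
      · have := hC.bounds _ h; omega
    · rcases hc g (by omega) (by omega) with ⟨j, hj, h | h | h⟩ | ⟨i, hi, h | h | h⟩
      · omega
      · exact Or.inl ⟨j, hj, h⟩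
      · have := hC.bounds _ h; omega
      · omega
      · exact Or.inr ⟨i, hi, h⟩
      · have := hC.bounds _ h; omega
    · rcases hc g (by omega) (by omega) with ⟨j, hj, h | h | h⟩ | ⟨i, hi, h | h | h⟩
      · omega
      · have := hB.bounds _ h; omega
      · exact Or.inl ⟨j, hj, h⟩
      · omega
      · have := hB.bounds _ h; omega
      · exact Or.inr ⟨i, hi, h⟩
  · rintro ⟨⟨hk, hQ⟩, ⟨hcB, hlB⟩, hcC, hlC⟩
    refine ⟨fun g hg hg' => ?_, ?_⟩
    · rcases eq_or_ne g a with rfl | hga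
      · exact Or.inl ⟨k, hk, Or.inl ⟨rfl, rfl⟩⟩
      · rcases lt_trichotomy (g + 1) k with h | h | h
        · rcases hcB g (by omega) h with ⟨j, hj, h⟩ | ⟨i, hi, h⟩
          · exact Or.inl ⟨j, hj, Or.inr (Or.inl h)⟩
          · exact Or.inr ⟨i, hi, Or.inr (Or.inl h)⟩
        · exact Or.inr ⟨a, by omega, Or.inl ⟨rfl, h⟩⟩
        · rcases hcC g (by omega) hg' with ⟨j, hj, h⟩ | ⟨i, hi, h⟩
          · exact Or.inl ⟨j, hj, Or.inr (Or.inr h)⟩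
          · exact Or.inr ⟨i, hi, Or.inr (Or.inr h)⟩
    · rintro p (rfl | hp | hp)
      · exact hQ
      · exact hlB p hp
      · exact hlC p hp

open Classical in
/-- The sum of `y ^ #A` over the covering noncrossing arc sets on `[a, b)`. -/
noncomputable def coveringSum (Q : ℕ → Prop) (y : ℤ) (a b : ℕ) : ℤ :=
  ∑ A ∈ arcSets a b, if IsCoveringArcSet Q a b A then y ^ #A else 0

theorem coveringSum_of_le (Q : ℕ → Prop) (y : ℤ) {a b : ℕ} (h : b ≤ a + 1) :
    coveringSum Q y a b = 1 := by
  rw [coveringSum, arcSets_eq_singleton h, Finset.sum_singleton, if_pos, card_empty, pow_zero]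
  exact ⟨fun g h1 h2 => by omega, by simp⟩

open Classical in
-- Arc sets with no arc leaving `a` contribute nothing, as they leave the first gap uncovered.
theorem coveringSum_rec (Q : ℕ → Prop) (y : ℤ) {a b : ℕ} (h : a + 1 < b) :
    coveringSum Q y a b = ∑ k ∈ Ioo a b, if a + 1 < k ∧ Q (k - a) then
      y * (coveringSum Q y (a + 1) k * coveringSum Q y k b) else 0 := by
  rw [coveringSum, sum_arcSets (by omega), Finset.sum_eq_zero, zero_add]
  · refine Finset.sum_congr rfl fun k hk => ?_
    rw [mem_Ioo] at hk
    by_cases hQ : a + 1 < k ∧ Q (k - a)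
    · rw [if_pos hQ, coveringSum, coveringSum, Finset.sum_mul_sum, Finset.mul_sum]
      refine Finset.sum_congr rfl fun B hB => ?_
      rw [Finset.mul_sum]
      refine Finset.sum_congr rfl fun C hC => ?_
      rw [mem_arcSets] at hB hC
      rw [isCoveringArcSet_join hk.1 hk.2 hB hC, card_join hk.1 hB hC]
      by_cases h1 : IsCoveringArcSet Q (a + 1) k B
      · by_cases h2 : IsCoveringArcSet Q k b C
        · rw [if_pos ⟨hQ, h1, h2⟩, if_pos h1, if_pos h2]
          ring
        · rw [if_neg (fun h => h2 h.2.2), if_neg h2]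
          ring
      · rw [if_neg (fun h => h1 h.2.1), if_neg h1]
        ring
    · rw [if_neg hQ]
      refine Finset.sum_eq_zero fun B hB => Finset.sum_eq_zero fun C hC => ?_
      rw [mem_arcSets] at hB hC
      rw [isCoveringArcSet_join hk.1 hk.2 hB hC, if_neg (fun h => hQ h.1)]
  · intro A hA
    rw [mem_arcSets] at hA
    rw [if_neg]
    intro hc
    rcases hc.cover a le_rfl h with ⟨j, hj, h⟩ | ⟨i, hi, h⟩
    · have := hA.bounds _ h
      omega
    · have := hA.bounds _ h
      omega

theorem coveringSum_eq_interleavedCatalan (y : ℤ) (m : ℕ) : ∀ a,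
    coveringSum (fun _ => True) y a (a + m) = interleavedCatalan y m := by
  induction m using Nat.strong_induction_on with
  | _ m ih =>
    intro a
    match m with
    | 0 => simp [coveringSum_of_le, interleavedCatalan]
    | 1 => simp [coveringSum_of_le, interleavedCatalan]
    | m + 2 =>
      rw [coveringSum_rec _ _ (by omega), sum_Ioo_eq_sum_range,
        show a + (m + 2) - (a + 1) = m + 1 by omega, Finset.sum_range_succ', if_neg (by omega),
        add_zero, interleavedCatalan_add_two, Finset.mul_sum]
      refine Finset.sum_congr rfl fun j hj => ?_
      rw [mem_range] at hj
      have h1 := ih (j + 1) (by omega) (a + 1)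
      have h2 := ih (m - j) (by omega) (a + 1 + (j + 1))
      rw [show a + 1 + (j + 1) + (m - j) = a + (m + 2) by omega] at h2
      rw [if_pos ⟨by omega, trivial⟩, h1, h2]

/-- Covering and the length bound force `k = a + 2`; the inside is then a single point, so each step
costs two points and one factor `y`. -/
theorem coveringSum_le_two (y : ℤ) (m : ℕ) : ∀ a,
    coveringSum (fun d => d ≤ 2) y a (a + (m + 1)) = if Even m then y ^ (m / 2) else 0 := by
  induction m using Nat.strong_induction_on with
  | _ m ih =>
    intro a
    match m with
    | 0 => simp [coveringSum_of_le]
    | 1 =>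
      rw [coveringSum_rec _ _ (by omega), Finset.sum_eq_zero]
      · simp
      · intro k hk
        rw [mem_Ioo] at hk
        rw [if_neg (by omega)]
    | m + 2 =>
      rw [coveringSum_rec _ _ (by omega), Finset.sum_eq_single (a + 2),
        if_pos ⟨by omega, by omega⟩, coveringSum_of_le _ _ (by omega),
        show a + (m + 2 + 1) = a + 2 + (m + 1) by ring, ih m (by omega)]
      · simp only [parity_simps, show (m + 2) / 2 = m / 2 + 1 by omega]
        split_ifs <;> simp_all [pow_succ, mul_comm]
      · intro k hk hk'
        rw [mem_Ioo] at hk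
        rw [if_neg (by omega)]
      · intro hk
        rw [mem_Ioo] at hk
        omega

end Recursions

/-! ### Counting supercharacters by labelled arc sets -/

section Counting

variable {N : ℕ} {F : Type*} [Field F]

/-- The set of positions of the nonzero entries, as pairs of natural numbers. -/
noncomputable def arcsOf (M : strictUpper N F) : Finset (ℕ × ℕ) :=
  (support M).map (Fin.valEmbedding.prodMap Fin.valEmbedding)

theorem mem_arcsOf {M : strictUpper N F} {i j : Fin N} :
    (i.val, j.val) ∈ arcsOf M ↔ M.1 i j ≠ 0 := by
  rw [arcsOf, ← mem_support (p := (i, j))]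
  exact Finset.mem_map' (Fin.valEmbedding.prodMap Fin.valEmbedding) (a := (i, j))

theorem exists_of_mem_arcsOf {M : strictUpper N F} {p : ℕ × ℕ} (h : p ∈ arcsOf M) :
    ∃ i j : Fin N, p = (i.val, j.val) ∧ M.1 i j ≠ 0 := by
  rw [arcsOf, Finset.mem_map] at h
  obtain ⟨⟨i, j⟩, h, rfl⟩ := h
  exact ⟨i, j, rfl, mem_support.1 h⟩

theorem isArcSet_arcsOf_iff {M : strictUpper N F} :
    IsArcSet 0 N (arcsOf M) ↔ IsQuasiMonomial M ∧ IsNoncrossingMatrix M := by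
  constructor
  · intro h
    refine ⟨⟨fun i j j' h1 h2 => ?_, fun i i' j h1 h2 => ?_⟩, fun i j k l h1 h2 h3 => ?_⟩
    · exact Fin.ext (congrArg Prod.snd
        (h.left_unique _ (mem_arcsOf.2 h1) _ (mem_arcsOf.2 h2) rfl))
    · exact Fin.ext (congrArg Prod.fst
        (h.right_unique _ (mem_arcsOf.2 h1) _ (mem_arcsOf.2 h2) rfl))
    · exact h.noncrossing _ (mem_arcsOf.2 h1) _ (mem_arcsOf.2 h2) h3
  · rintro ⟨hM, hnc⟩
    constructor
    · intro p hp
      obtain ⟨i, j, rfl, h⟩ := exists_of_mem_arcsOf hp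
      exact ⟨Nat.zero_le _, lt_of_ne_zero h, j.2⟩
    · intro p hp q hq hpq
      obtain ⟨i, j, rfl, h⟩ := exists_of_mem_arcsOf hp
      obtain ⟨i', j', rfl, h'⟩ := exists_of_mem_arcsOf hq
      obtain rfl : i = i' := Fin.ext hpq
      rw [hM.1 _ _ _ h h']
    · intro p hp q hq hpq
      obtain ⟨i, j, rfl, h⟩ := exists_of_mem_arcsOf hp
      obtain ⟨i', j', rfl, h'⟩ := exists_of_mem_arcsOf hq
      obtain rfl : j = j' := Fin.ext hpq
      rw [hM.2 _ _ _ h h']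
    · intro p hp q hq hpq
      obtain ⟨i, j, rfl, h⟩ := exists_of_mem_arcsOf hp
      obtain ⟨i', j', rfl, h'⟩ := exists_of_mem_arcsOf hq
      exact hnc _ _ _ _ h h' hpq

theorem isCoveringArcSet_arcsOf_iff {n : ℕ} {M : strictUpper (n + 1) F} {Q : ℕ → Prop} :
    IsCoveringArcSet Q 0 (n + 1) (arcsOf M) ↔
      IsCoveringMatrix M ∧ ∀ i j, M.1 i j ≠ 0 → Q (j.val - i.val) := by
  rw [isCoveringArcSet_iff]
  refine and_congr ⟨fun h k => ?_, fun h g _ hg => ?_⟩ ⟨fun h i j hij => ?_, fun h p hp => ?_⟩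
  · rcases h k.val (Nat.zero_le _) (by omega) with ⟨j, hj, hm⟩ | ⟨i, hi, hm⟩
    · obtain ⟨i', j', heq, hm'⟩ := exists_of_mem_arcsOf hm
      rw [Prod.mk.injEq] at heq
      obtain rfl : k.castSucc = i' := Fin.ext heq.1
      exact Or.inl ⟨j', Fin.lt_def.2 (by rw [← heq.2]; exact hj), hm'⟩
    · obtain ⟨i', j', heq, hm'⟩ := exists_of_mem_arcsOf hm
      rw [Prod.mk.injEq] at heq
      obtain rfl : k.succ = j' := Fin.ext heq.2
      exact Or.inr ⟨i', Fin.lt_def.2 (by rw [← heq.1]; exact hi), hm'⟩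
  · rcases h ⟨g, by omega⟩ with ⟨j, hj, hm⟩ | ⟨i, hi, hm⟩
    · exact Or.inl ⟨j.val, hj, mem_arcsOf.2 hm⟩
    · exact Or.inr ⟨i.val, hi, mem_arcsOf.2 hm⟩
  · exact h _ (mem_arcsOf.2 hij)
  · obtain ⟨i, j, rfl, h'⟩ := exists_of_mem_arcsOf hp
    exact h i j h'

variable [Fintype F]

open Classical in
-- Each arc carries an independent label in the unit group; this is the source of the weight `q -
-- 1`.
theorem card_filter_arcsOf_eq {A : Finset (ℕ × ℕ)} (hA : IsArcSet 0 N A) :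
    #{M : strictUpper N F | arcsOf M = A} = (Fintype.card F - 1) ^ #A := by
  rw [← Fintype.card_units, ← Fintype.card_coe A, ← Fintype.card_fun, ← Finset.card_univ]
  symm
  have hstrict : ∀ f : A → Fˣ, (fun i j : Fin N =>
      if h : (i.val, j.val) ∈ A then (f ⟨_, h⟩ : F) else 0) ∈ strictUpper N F := by
    intro f i j hji
    refine dif_neg fun h => ?_
    have := (hA.bounds _ h).2.1
    exact absurd hji (not_le.2 this)
  refine Finset.card_bij (fun f _ => ⟨_, hstrict f⟩) ?_ ?_ ?_
  · intro f _
    rw [mem_filter]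
    refine ⟨mem_univ _, ?_⟩
    ext p
    constructor
    · intro hp
      obtain ⟨i, j, rfl, h⟩ := exists_of_mem_arcsOf hp
      by_contra hn
      exact h (dif_neg hn)
    · intro hp
      have hb := hA.bounds p hp
      have h : (((⟨p.1, by omega⟩ : Fin N).val, (⟨p.2, hb.2.2⟩ : Fin N).val) : ℕ × ℕ) ∈
          arcsOf (⟨_, hstrict f⟩ : strictUpper N F) := by
        rw [mem_arcsOf]
        change (if h : p ∈ A then (f ⟨_, h⟩ : F) else 0) ≠ 0
        rw [dif_pos hp]
        exact (f _).ne_zero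
      exact h
  · intro f _ f' _ h
    funext ⟨p, hp⟩
    have hb := hA.bounds p hp
    have h1 := congrFun (congrFun (congrArg Subtype.val h) ⟨p.1, by omega⟩) ⟨p.2, hb.2.2⟩
    change (if h : p ∈ A then (f ⟨_, h⟩ : F) else 0) = if h : p ∈ A then (f' ⟨_, h⟩ : F) else 0
      at h1
    rw [dif_pos hp, dif_pos hp] at h1
    exact Units.ext h1
  · intro M hM
    obtain rfl := (mem_filter.1 hM).2
    have hne : ∀ p : arcsOf M, M.1 ⟨p.1.1, by have := hA.bounds _ p.2; omega⟩
        ⟨p.1.2, (hA.bounds _ p.2).2.2⟩ ≠ 0 := by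
      intro p
      exact mem_arcsOf.1 p.2
    refine ⟨fun p => Units.mk0 _ (hne p), mem_univ _, ?_⟩
    apply Subtype.ext
    ext i j
    change (if h : (i.val, j.val) ∈ arcsOf M then _ else 0) = _
    split_ifs with h
    · rfl
    · by_contra hn
      exact h (mem_arcsOf.2 (Ne.symm hn))

theorem ncard_normalForms {n : ℕ} (Q : ℕ → Prop) :
    (({M : strictUpper (n + 1) F | (IsQuasiMonomial M ∧ IsNoncrossingMatrix M) ∧
      IsCoveringMatrix M ∧ ∀ i j, M.1 i j ≠ 0 → Q (j.val - i.val)}.ncard : ℕ) : ℤ) =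
      coveringSum Q (Fintype.card F - 1) 0 (n + 1) := by
  classical
  have h1 : {M : strictUpper (n + 1) F | (IsQuasiMonomial M ∧ IsNoncrossingMatrix M) ∧
      IsCoveringMatrix M ∧ ∀ i j, M.1 i j ≠ 0 → Q (j.val - i.val)} =
      ((univ.filter fun M : strictUpper (n + 1) F =>
        IsArcSet 0 (n + 1) (arcsOf M) ∧ IsCoveringArcSet Q 0 (n + 1) (arcsOf M) :
          Finset (strictUpper (n + 1) F)) : Set (strictUpper (n + 1) F)) := by
    ext M
    simp [isArcSet_arcsOf_iff, isCoveringArcSet_arcsOf_iff]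
  rw [h1, Set.ncard_coe_finset, coveringSum, ← Finset.sum_filter,
    Finset.card_eq_sum_card_fiberwise (f := arcsOf)
      (t := (arcSets 0 (n + 1)).filter (IsCoveringArcSet Q 0 (n + 1)))]
  · push_cast
    refine Finset.sum_congr rfl fun A hA => ?_
    rw [mem_filter, mem_arcSets] at hA
    have h2 := card_filter_arcsOf_eq (F := F) hA.1
    rw [Finset.filter_filter, Finset.filter_congr (q := fun M => arcsOf M = A), h2]
    · rw [Nat.cast_pow, Nat.cast_sub Fintype.card_pos, Nat.cast_one]
    · intro M _
      constructor
      · exact fun h => h.2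
      · rintro rfl
        exact ⟨hA, rfl⟩
  · intro M hM
    rw [mem_coe, mem_filter] at hM
    rw [mem_coe, mem_filter, mem_arcSets]
    exact hM.2

/-- Treats both counts at once, `Q` being the restriction on arc lengths: none for irreducible, at
most 2 for Heisenberg. Normal forms give a bijective parametrisation. -/
theorem ncard_supercharacters {n : ℕ} {θ : AddChar F ℂ} (hθ : θ ≠ 1) (Q : ℕ → Prop)
    (P : (unitriangular (n + 1) F → ℂ) → Prop)
    (hP : ∀ M : strictUpper (n + 1) F, IsQuasiMonomial M →
      (P (superCharacter θ (dualOf M)) ↔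
        IsNoncrossingMatrix M ∧ ∀ i j, M.1 i j ≠ 0 → Q (j.val - i.val))) :
    (({χ : unitriangular (n + 1) F → ℂ | IsSupercharacter θ χ ∧ P χ ∧ IsCInvariant χ}.ncard : ℕ)
      : ℤ) = coveringSum Q (Fintype.card F - 1) 0 (n + 1) := by
  rw [← ncard_normalForms]
  congr 1
  rw [← Set.InjOn.ncard_image (f := fun M => superCharacter θ (dualOf M))]
  · congr 1
    ext χ
    constructor
    · rintro ⟨⟨l, rfl⟩, hPl, hC⟩
      obtain ⟨M, hM, hlM⟩ := exists_isQuasiMonomial_sameOrbit l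
      have heq : superCharacter θ l = superCharacter θ (dualOf M) :=
        (superCharacter_eq_iff hθ).2 hlM
      change P (superCharacter θ l) at hPl
      change IsCInvariant (superCharacter θ l) at hC
      rw [heq] at hPl hC
      have h1 := (hP M hM).1 hPl
      exact ⟨M, ⟨⟨hM, h1.1⟩, (isCInvariant_dualOf_iff hθ hM h1.1).1 hC, h1.2⟩, heq.symm⟩
    · rintro ⟨M, ⟨⟨hM, hnc⟩, hcov, hQ⟩, rfl⟩
      exact ⟨⟨_, rfl⟩, (hP M hM).2 ⟨hnc, hQ⟩, (isCInvariant_dualOf_iff hθ hM hnc).2 hcov⟩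
  · intro M hM L hL h
    exact hM.1.1.eq_of_sameOrbit hL.1.1 ((superCharacter_eq_iff hθ).1 h)

theorem ncard_irreducible_supercharacters {n : ℕ} {θ : AddChar F ℂ} (hθ : θ ≠ 1) :
    (({χ : unitriangular (n + 1) F → ℂ |
      IsSupercharacter θ χ ∧ IsIrreducibleCharacter χ ∧ IsCInvariant χ}.ncard : ℕ) : ℤ) =
      interleavedCatalan (Fintype.card F - 1) (n + 1) := by
  rw [ncard_supercharacters hθ (fun _ => True) IsIrreducibleCharacter]
  · have := coveringSum_eq_interleavedCatalan (Fintype.card F - 1) (n + 1) 0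
    rwa [zero_add] at this
  · intro M hM
    rw [isIrreducibleCharacter_dualOf_iff hθ hM]
    simp

theorem ncard_heisenberg_supercharacters {n : ℕ} {θ : AddChar F ℂ} (hθ : θ ≠ 1) :
    (({χ : unitriangular (n + 1) F → ℂ |
      IsSupercharacter θ χ ∧ IsHeisenbergCharacter χ ∧ IsCInvariant χ}.ncard : ℕ) : ℤ) =
      if Even n then ((Fintype.card F : ℤ) - 1) ^ (n / 2) else 0 := by
  rw [ncard_supercharacters hθ (fun d => d ≤ 2) IsHeisenbergCharacter]
  · have := coveringSum_le_two (Fintype.card F - 1) n 0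
    rwa [zero_add] at this
  · intro M hM
    rw [isHeisenbergCharacter_dualOf_iff hθ hM]
    simp only [tsub_le_iff_right, add_comm 2]

end Counting

/-! ### Delannoy numbers and the Pell polynomial at `-1` -/

section Delannoy

/-- The lattice paths from `(0, 0)` to `(a, b)`. -/
def delannoyPaths (a b : ℕ) : Set (List (ℕ × ℕ)) :=
  {P | (∀ s ∈ P, s = (1, 0) ∨ s = (1, 1) ∨ s = (0, 1)) ∧ P.sum = (a, b)}

theorem delannoyNumber_eq (a b : ℕ) : delannoyNumber a b = (delannoyPaths a b).ncard := rfl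

theorem delannoyPaths_zero_zero : delannoyPaths 0 0 = {[]} := by
  ext P
  constructor
  · rintro ⟨h1, h2⟩
    cases P with
    | nil => rfl
    | cons s P =>
      rw [List.sum_cons, Prod.ext_iff] at h2
      have h3 := h1 s List.mem_cons_self
      simp only [Prod.fst_add, Prod.snd_add] at h2
      rcases h3 with rfl | rfl | rfl <;> simp at h2
  · rintro rfl
    exact ⟨by simp, rfl⟩

theorem cons_mem_delannoyPaths {s : ℕ × ℕ} {P : List (ℕ × ℕ)} {a b : ℕ} :
    s :: P ∈ delannoyPaths a b ↔ (s = (1, 0) ∨ s = (1, 1) ∨ s = (0, 1)) ∧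
      ∃ c d, P ∈ delannoyPaths c d ∧ s + (c, d) = (a, b) := by
  constructor
  · rintro ⟨h1, h2⟩
    rw [List.forall_mem_cons] at h1
    exact ⟨h1.1, P.sum.1, P.sum.2, ⟨h1.2, rfl⟩, by rw [← h2, List.sum_cons]⟩
  · rintro ⟨h1, c, d, ⟨h2, h3⟩, h4⟩
    exact ⟨List.forall_mem_cons.2 ⟨h1, h2⟩, by rw [List.sum_cons, h3, h4]⟩

theorem delannoyPaths_succ_zero (a : ℕ) :
    delannoyPaths (a + 1) 0 = List.cons (1, 0) '' delannoyPaths a 0 := by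
  ext P
  cases P with
  | nil => simp [delannoyPaths, Prod.ext_iff]
  | cons s P =>
    rw [cons_mem_delannoyPaths]
    constructor
    · rintro ⟨rfl | rfl | rfl, c, d, h, heq⟩ <;> simp only [Prod.mk_add_mk, Prod.mk.injEq] at heq
      · obtain ⟨rfl, rfl⟩ : c = a ∧ d = 0 := by omega
        exact ⟨P, h, rfl⟩
      · omega
      · omega
    · rintro ⟨P', h, heq⟩
      cases heq
      exact ⟨Or.inl rfl, a, 0, h, by simp [add_comm]⟩

theorem delannoyPaths_zero_succ (b : ℕ) :
    delannoyPaths 0 (b + 1) = List.cons (0, 1) '' delannoyPaths 0 b := by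
  ext P
  cases P with
  | nil => simp [delannoyPaths, Prod.ext_iff]
  | cons s P =>
    rw [cons_mem_delannoyPaths]
    constructor
    · rintro ⟨rfl | rfl | rfl, c, d, h, heq⟩ <;> simp only [Prod.mk_add_mk, Prod.mk.injEq] at heq
      · omega
      · omega
      · obtain ⟨rfl, rfl⟩ : c = 0 ∧ d = b := by omega
        exact ⟨P, h, rfl⟩
    · rintro ⟨P', h, heq⟩
      cases heq
      exact ⟨Or.inr (Or.inr rfl), 0, b, h, by simp [add_comm]⟩

theorem delannoyPaths_succ_succ (a b : ℕ) :
    delannoyPaths (a + 1) (b + 1) = List.cons (1, 0) '' delannoyPaths a (b + 1) ∪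
      (List.cons (1, 1) '' delannoyPaths a b ∪ List.cons (0, 1) '' delannoyPaths (a + 1) b) := by
  ext P
  cases P with
  | nil => simp [delannoyPaths, Prod.ext_iff]
  | cons s P =>
    rw [cons_mem_delannoyPaths]
    constructor
    · rintro ⟨rfl | rfl | rfl, c, d, h, heq⟩ <;> simp only [Prod.mk_add_mk, Prod.mk.injEq] at heq
      · obtain ⟨rfl, rfl⟩ : c = a ∧ d = b + 1 := by omega
        exact Or.inl ⟨P, h, rfl⟩
      · obtain ⟨rfl, rfl⟩ : c = a ∧ d = b := by omega
        exact Or.inr (Or.inl ⟨P, h, rfl⟩)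
      · obtain ⟨rfl, rfl⟩ : c = a + 1 ∧ d = b := by omega
        exact Or.inr (Or.inr ⟨P, h, rfl⟩)
    · rintro (⟨P', h, heq⟩ | ⟨P', h, heq⟩ | ⟨P', h, heq⟩)
      · cases heq
        exact ⟨Or.inl rfl, a, b + 1, h, by simp [add_comm]⟩
      · cases heq
        exact ⟨Or.inr (Or.inl rfl), a, b, h, by simp [add_comm]⟩
      · cases heq
        exact ⟨Or.inr (Or.inr rfl), a + 1, b, h, by simp [add_comm]⟩

theorem delannoyPaths_finite : ∀ a b, (delannoyPaths a b).Finite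
  | 0, 0 => by rw [delannoyPaths_zero_zero]; exact Set.finite_singleton _
  | a + 1, 0 => by rw [delannoyPaths_succ_zero]; exact (delannoyPaths_finite a 0).image _
  | 0, b + 1 => by rw [delannoyPaths_zero_succ]; exact (delannoyPaths_finite 0 b).image _
  | a + 1, b + 1 => by
    rw [delannoyPaths_succ_succ]
    exact ((delannoyPaths_finite a (b + 1)).image _).union
      (((delannoyPaths_finite a b).image _).union ((delannoyPaths_finite (a + 1) b).image _))

theorem delannoyNumber_zero_right (a : ℕ) : delannoyNumber a 0 = 1 := by
  induction a with
  | zero => rw [delannoyNumber_eq, delannoyPaths_zero_zero, Set.ncard_singleton]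
  | succ a ih =>
    rwa [delannoyNumber_eq, delannoyPaths_succ_zero,
      Set.ncard_image_of_injective _ List.cons_injective]

theorem delannoyNumber_zero_left (b : ℕ) : delannoyNumber 0 b = 1 := by
  induction b with
  | zero => rw [delannoyNumber_eq, delannoyPaths_zero_zero, Set.ncard_singleton]
  | succ a ih =>
    rwa [delannoyNumber_eq, delannoyPaths_zero_succ,
      Set.ncard_image_of_injective _ List.cons_injective]

theorem delannoyNumber_succ_succ (a b : ℕ) : delannoyNumber (a + 1) (b + 1) =
    delannoyNumber a (b + 1) + (delannoyNumber a b + delannoyNumber (a + 1) b) := by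
  have hdisj : ∀ {s t : ℕ × ℕ} (A B : Set (List (ℕ × ℕ))), s ≠ t →
      Disjoint (List.cons s '' A) (List.cons t '' B) := by
    intro s t A B hst
    rw [Set.disjoint_left]
    rintro _ ⟨P, _, rfl⟩ ⟨P', _, h⟩
    exact hst (List.cons.inj h).1.symm
  have hinj : ∀ (s : ℕ × ℕ) (A : Set (List (ℕ × ℕ))), (List.cons s '' A).ncard = A.ncard :=
    fun s A => Set.ncard_image_of_injective _ List.cons_injective
  have hfin : ∀ s a b, (List.cons s '' delannoyPaths a b).Finite :=
    fun s a b => (delannoyPaths_finite a b).image _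
  rw [delannoyNumber_eq, delannoyPaths_succ_succ, Set.ncard_union_eq _ (hfin _ _ _)
    ((hfin _ _ _).union (hfin _ _ _)), Set.ncard_union_eq (hdisj _ _ (by simp)) (hfin _ _ _)
    (hfin _ _ _), hinj, hinj, hinj]
  · rfl
  · rw [Set.disjoint_union_right]
    exact ⟨hdisj _ _ (by simp), hdisj _ _ (by simp)⟩

theorem pellPolynomialSucc_eval (n : ℕ) : (pellPolynomialSucc n).eval (-1) =
    ∑ p ∈ antidiagonal n, (delannoyNumber p.1 p.2 : ℤ) * (-1) ^ p.2 := by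
  rw [pellPolynomialSucc, Polynomial.eval_finsetSum,
    ← Finset.Nat.sum_antidiagonal_swap, Finset.Nat.sum_antidiagonal_eq_sum_range_succ_mk]
  refine Finset.sum_congr rfl fun k _ => ?_
  simp

/-- In the signed antidiagonal sum of the Delannoy recurrence, horizontal and vertical steps cancel,
boundary terms included, and the diagonal step leaves a sign. -/
theorem pellPolynomialSucc_eval_add_two (n : ℕ) :
    (pellPolynomialSucc (n + 2)).eval (-1) = -(pellPolynomialSucc n).eval (-1) := by
  -- The value at `n + 1` is expanded twice, splitting off one end of the antidiagonal or the other;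
  -- subtracting the expansions eliminates it.
  have h1 : (pellPolynomialSucc (n + 1)).eval (-1) =
      1 + ∑ p ∈ antidiagonal n, (delannoyNumber p.1 (p.2 + 1) : ℤ) * (-1) ^ (p.2 + 1) := by
    rw [pellPolynomialSucc_eval, Finset.Nat.antidiagonal_succ', Finset.sum_cons, Finset.sum_map]
    simp [delannoyNumber_zero_right]
  have h2 : (pellPolynomialSucc (n + 1)).eval (-1) = (-1) ^ (n + 1) +
      ∑ p ∈ antidiagonal n, (delannoyNumber (p.1 + 1) p.2 : ℤ) * (-1) ^ p.2 := by
    rw [pellPolynomialSucc_eval, Finset.Nat.antidiagonal_succ, Finset.sum_cons, Finset.sum_map]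
    simp [delannoyNumber_zero_left]
  have h3 : (pellPolynomialSucc (n + 2)).eval (-1) = (-1) ^ (n + 2) + (1 +
      ∑ p ∈ antidiagonal n, (delannoyNumber (p.1 + 1) (p.2 + 1) : ℤ) * (-1) ^ (p.2 + 1)) := by
    rw [pellPolynomialSucc_eval, Finset.Nat.antidiagonal_succ_succ', Finset.sum_cons,
      Finset.sum_cons, Finset.sum_map]
    simp [delannoyNumber_zero_left, delannoyNumber_zero_right]
  have h4 : ∑ p ∈ antidiagonal n, (delannoyNumber (p.1 + 1) (p.2 + 1) : ℤ) * (-1) ^ (p.2 + 1) =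
      ∑ p ∈ antidiagonal n, (delannoyNumber p.1 (p.2 + 1) : ℤ) * (-1) ^ (p.2 + 1) -
      ∑ p ∈ antidiagonal n, (delannoyNumber p.1 p.2 : ℤ) * (-1) ^ p.2 -
      ∑ p ∈ antidiagonal n, (delannoyNumber (p.1 + 1) p.2 : ℤ) * (-1) ^ p.2 := by
    rw [← Finset.sum_sub_distrib, ← Finset.sum_sub_distrib]
    refine Finset.sum_congr rfl fun p _ => ?_
    rw [delannoyNumber_succ_succ]
    push_cast
    ring
  rw [pellPolynomialSucc_eval n, h3, h4]
  linear_combination h2 - h1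

theorem pellPolynomialSucc_eval_neg_one (n : ℕ) :
    (pellPolynomialSucc n).eval (-1) = if Even n then (-1) ^ (n / 2) else 0 := by
  induction n using Nat.strong_induction_on with
  | _ n ih =>
    match n with
    | 0 => simp [pellPolynomialSucc, delannoyNumber_zero_right]
    | 1 =>
      rw [pellPolynomialSucc]
      simp [Finset.sum_range_succ, delannoyNumber_zero_right, delannoyNumber_zero_left]
    | n + 2 =>
      rw [pellPolynomialSucc_eval_add_two, ih n (by omega)]
      simp only [parity_simps, show (n + 2) / 2 = n / 2 + 1 by omega]
      split_ifs <;> simp_all [pow_succ]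

end Delannoy

/-! ### Noncrossing partitions and their arc sets -/

section Narayana

variable {m : ℕ}

theorem part_eq_part_iff (P : Finpartition (univ : Finset (Fin m))) {i j : Fin m} :
    P.part i = P.part j ↔ i ∈ P.part j :=
  (P.mem_part_iff_part_eq_part (mem_univ i) (mem_univ j)).symm

theorem isArc_iff (P : Finpartition (univ : Finset (Fin m))) {i j : Fin m} :
    IsArc P i j ↔ i < j ∧ P.part i = P.part j ∧ ∀ k, i < k → k < j → P.part k ≠ P.part j := by
  constructor
  · rintro ⟨hij, B, hB, hi, hj, h⟩
    have h1 := P.part_eq_of_mem hB hi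
    have h2 := P.part_eq_of_mem hB hj
    refine ⟨hij, h1.trans h2.symm, fun k hk hk' heq => ?_⟩
    rw [part_eq_part_iff, h2] at heq
    exact h k heq ⟨hk, hk'⟩
  · rintro ⟨hij, h1, h⟩
    refine ⟨hij, P.part j, P.part_mem.2 (mem_univ _), (part_eq_part_iff P).1 h1,
      P.mem_part_self.2 (mem_univ _), fun k hk hk' => ?_⟩
    exact h k hk'.1 hk'.2 ((part_eq_part_iff P).2 hk)

theorem IsArc.left_unique {P : Finpartition (univ : Finset (Fin m))} {i j j' : Fin m}
    (h : IsArc P i j) (h' : IsArc P i j') : j = j' := by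
  rw [isArc_iff] at h h'
  by_contra hne
  rcases lt_or_gt_of_ne hne with hlt | hlt
  · exact h'.2.2 j h.1 hlt (h.2.1.symm.trans h'.2.1)
  · exact h.2.2 j' h'.1 hlt (h'.2.1.symm.trans h.2.1)

theorem IsArc.right_unique {P : Finpartition (univ : Finset (Fin m))} {i i' j : Fin m}
    (h : IsArc P i j) (h' : IsArc P i' j) : i = i' := by
  rw [isArc_iff] at h h'
  by_contra hne
  rcases lt_or_gt_of_ne hne with hlt | hlt
  · exact h.2.2 i' hlt h'.1 h'.2.1
  · exact h'.2.2 i hlt h.1 h.2.1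

/-- Take for `k` the predecessor of `j` in its block. -/
theorem exists_isArc_right (P : Finpartition (univ : Finset (Fin m))) {i j : Fin m}
    (hij : i < j) (h : P.part i = P.part j) : ∃ k, IsArc P k j ∧ i ≤ k := by
  have hne : ((P.part j).filter (· < j)).Nonempty :=
    ⟨i, mem_filter.2 ⟨(part_eq_part_iff P).1 h, hij⟩⟩
  have hmem := mem_filter.1 (Finset.max'_mem _ hne)
  refine ⟨((P.part j).filter (· < j)).max' hne, (isArc_iff P).2
    ⟨hmem.2, (part_eq_part_iff P).2 hmem.1, fun k hk hk' heq => ?_⟩, ?_⟩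
  · exact hk.not_ge (Finset.le_max' _ _ (mem_filter.2 ⟨(part_eq_part_iff P).1 heq, hk'⟩))
  · exact Finset.le_max' _ _ (mem_filter.2 ⟨(part_eq_part_iff P).1 h, hij⟩)

/-- Descend from `j` along arcs: elements of a block are joined by chains of arcs, so the arcs
determine the partition. -/
theorem part_eq_of_isArc {P P' : Finpartition (univ : Finset (Fin m))}
    (h : ∀ i j, IsArc P i j → IsArc P' i j) (j : Fin m) :
    ∀ i, i < j → P.part i = P.part j → P'.part i = P'.part j := by
  induction j using WellFoundedLT.induction with
  | _ j ih =>
    intro i hij hpart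
    obtain ⟨k, hk, hik⟩ := exists_isArc_right P hij hpart
    have hkj := ((isArc_iff P').1 (h k j hk)).2.1
    rcases hik.lt_or_eq with hik | rfl
    · exact (ih k hk.1 i hik (hpart.trans ((isArc_iff P).1 hk).2.1.symm)).trans hkj
    · exact hkj

theorem finpartition_eq_of_isArc {P P' : Finpartition (univ : Finset (Fin m))}
    (h : ∀ i j, IsArc P i j ↔ IsArc P' i j) : P = P' := by
  have hpart : ∀ i j, P.part i = P.part j ↔ P'.part i = P'.part j := by
    intro i j
    rcases lt_trichotomy i j with hij | rfl | hij
    · exact ⟨part_eq_of_isArc (fun i j => (h i j).1) j i hij,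
        part_eq_of_isArc (fun i j => (h i j).2) j i hij⟩
    · simp
    · rw [eq_comm, eq_comm (a := P'.part i)]
      exact ⟨part_eq_of_isArc (fun i j => (h i j).1) i j hij,
        part_eq_of_isArc (fun i j => (h i j).2) i j hij⟩
  have hpart' : ∀ j, P.part j = P'.part j := by
    intro j
    ext i
    rw [← part_eq_part_iff, ← part_eq_part_iff, hpart]
  have hparts : ∀ Q : Finpartition (univ : Finset (Fin m)), Q.parts = univ.image Q.part := by
    intro Q
    ext B
    rw [mem_image]
    constructor
    · intro hB
      obtain ⟨x, hx⟩ := Q.nonempty_of_mem_parts hB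
      exact ⟨x, mem_univ _, Q.part_eq_of_mem hB hx⟩
    · rintro ⟨x, _, rfl⟩
      exact Q.part_mem.2 (mem_univ _)
  apply Finpartition.ext
  rw [hparts, hparts]
  exact Finset.image_congr fun j _ => hpart' j

open Classical in
/-- The arcs of a set partition, as pairs of natural numbers. -/
noncomputable def partitionArcs (P : Finpartition (univ : Finset (Fin m))) : Finset (ℕ × ℕ) :=
  (univ.filter fun p : Fin m × Fin m => IsArc P p.1 p.2).map
    (Fin.valEmbedding.prodMap Fin.valEmbedding)

theorem mem_partitionArcs {P : Finpartition (univ : Finset (Fin m))} {i j : Fin m} :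
    (i.val, j.val) ∈ partitionArcs P ↔ IsArc P i j := by
  classical
  rw [partitionArcs]
  refine (Finset.mem_map' (Fin.valEmbedding.prodMap Fin.valEmbedding) (a := (i, j))).trans ?_
  simp

theorem exists_of_mem_partitionArcs {P : Finpartition (univ : Finset (Fin m))} {p : ℕ × ℕ}
    (h : p ∈ partitionArcs P) : ∃ i j : Fin m, p = (i.val, j.val) ∧ IsArc P i j := by
  classical
  rw [partitionArcs, Finset.mem_map] at h
  obtain ⟨⟨i, j⟩, h, rfl⟩ := h
  exact ⟨i, j, rfl, (mem_filter.1 h).2⟩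

theorem isArcSet_partitionArcs {P : Finpartition (univ : Finset (Fin m))}
    (hP : IsNoncrossing P) : IsArcSet 0 m (partitionArcs P) := by
  constructor
  · intro p hp
    obtain ⟨i, j, rfl, h⟩ := exists_of_mem_partitionArcs hp
    exact ⟨Nat.zero_le _, h.1, j.2⟩
  · intro p hp q hq hpq
    obtain ⟨i, j, rfl, h⟩ := exists_of_mem_partitionArcs hp
    obtain ⟨i', j', rfl, h'⟩ := exists_of_mem_partitionArcs hq
    obtain rfl : i = i' := Fin.ext hpq
    rw [h.left_unique h']
  · intro p hp q hq hpq
    obtain ⟨i, j, rfl, h⟩ := exists_of_mem_partitionArcs hp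
    obtain ⟨i', j', rfl, h'⟩ := exists_of_mem_partitionArcs hq
    obtain rfl : j = j' := Fin.ext hpq
    rw [h.right_unique h']
  · intro p hp q hq hpq
    obtain ⟨i, j, rfl, h⟩ := exists_of_mem_partitionArcs hp
    obtain ⟨i', j', rfl, h'⟩ := exists_of_mem_partitionArcs hq
    exact hP _ _ _ _ h h' hpq

/-- Each element is either the right end of exactly one arc or the minimum of its block, so the
exponent `m - k` in the Narayana polynomial counts arcs. -/
theorem card_partitionArcs_add_card_parts (P : Finpartition (univ : Finset (Fin m))) :
    #(partitionArcs P) + #P.parts = m := by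
  classical
  have h1 : #(partitionArcs P) = #(univ.filter fun j : Fin m => ∃ i, IsArc P i j) := by
    rw [partitionArcs, card_map]
    refine Finset.card_bij (fun p _ => p.2) ?_ ?_ ?_
    · intro p hp
      exact mem_filter.2 ⟨mem_univ _, p.1, (mem_filter.1 hp).2⟩
    · rintro ⟨i, j⟩ h ⟨i', j'⟩ h' heq
      dsimp only at heq
      subst heq
      exact Prod.ext ((mem_filter.1 h).2.right_unique (mem_filter.1 h').2) rfl
    · intro j hj
      obtain ⟨i, hi⟩ := (mem_filter.1 hj).2
      exact ⟨(i, j), mem_filter.2 ⟨mem_univ _, hi⟩, rfl⟩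
  have h2 : #P.parts = #(univ.filter fun j : Fin m => ¬ ∃ i, IsArc P i j) := by
    symm
    refine Finset.card_bij (fun j _ => P.part j) ?_ ?_ ?_
    · intro j _
      exact P.part_mem.2 (mem_univ _)
    · intro j hj j' hj' heq
      by_contra hne
      rcases lt_or_gt_of_ne hne with hlt | hlt
      · obtain ⟨k, hk, _⟩ := exists_isArc_right P hlt heq
        exact (mem_filter.1 hj').2 ⟨k, hk⟩
      · obtain ⟨k, hk, _⟩ := exists_isArc_right P hlt heq.symm
        exact (mem_filter.1 hj).2 ⟨k, hk⟩
    · intro B hB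
      have hne := P.nonempty_of_mem_parts hB
      have hpart := P.part_eq_of_mem hB (B.min'_mem hne)
      refine ⟨B.min' hne, mem_filter.2 ⟨mem_univ _, ?_⟩, hpart⟩
      rintro ⟨i, hi⟩
      have h3 := ((isArc_iff P).1 hi).2.1
      rw [part_eq_part_iff, hpart] at h3
      exact hi.1.not_ge (Finset.min'_le _ _ h3)
  rw [h1, h2, Finset.card_filter_add_card_filter_not, card_univ, Fintype.card_fin]

/-- The relation given by the arcs in a set of arcs. -/
def arcRel (m : ℕ) (A : Finset (ℕ × ℕ)) (i j : Fin m) : Prop := (i.val, j.val) ∈ A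

theorem arcRel_le {A : Finset (ℕ × ℕ)} (hA : IsArcSet 0 m A) {i j : Fin m}
    (h : Relation.ReflTransGen (arcRel m A) i j) : i ≤ j := by
  induction h with
  | refl => exact le_rfl
  | tail _ h ih => exact ih.trans (Fin.le_def.2 (hA.bounds _ h).2.1.le)

/-- The equivalence relation generated by an arc set. -/
def arcSetoid {A : Finset (ℕ × ℕ)} (hA : IsArcSet 0 m A) : Setoid (Fin m) where
  r i j := Relation.ReflTransGen (arcRel m A) i j ∨ Relation.ReflTransGen (arcRel m A) j i
  iseqv := by
    -- Transitivity needs uniqueness of arcs at each end: two chains from a common point, or into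
    -- one, are then comparable.
    have hleft : Relator.RightUnique (arcRel m A) := fun i j j' h h' =>
      Fin.ext (congrArg Prod.snd (hA.left_unique _ h _ h' rfl))
    have hright : Relator.RightUnique (Function.swap (arcRel m A)) := fun j i i' h h' =>
      Fin.ext (congrArg Prod.fst (hA.right_unique _ h _ h' rfl))
    refine ⟨fun i => Or.inl .refl, fun h => h.symm, ?_⟩
    rintro i j k (h | h) (h' | h')
    · exact Or.inl (h.trans h')
    · have := Relation.ReflTransGen.total_of_right_unique hright
        (Relation.reflTransGen_swap.2 h) (Relation.reflTransGen_swap.2 h')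
      exact this.symm.imp Relation.reflTransGen_swap.1 Relation.reflTransGen_swap.1
    · exact Relation.ReflTransGen.total_of_right_unique hleft h h'
    · exact Or.inr (h'.trans h)

/-- The blocks are the maximal chains of `A`; uniqueness of the arc leaving a point shows that no
new arcs appear. -/
theorem exists_partitionArcs_eq {A : Finset (ℕ × ℕ)} (hA : IsArcSet 0 m A) :
    ∃ P : Finpartition (univ : Finset (Fin m)), IsNoncrossing P ∧ partitionArcs P = A := by
  classical
  let P := Finpartition.ofSetoid (arcSetoid hA)
  have hP : ∀ i j, i < j → (P.part i = P.part j ↔ Relation.ReflTransGen (arcRel m A) i j) := by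
    intro i j hij
    rw [part_eq_part_iff, Finpartition.mem_part_ofSetoid_iff_rel]
    constructor
    · rintro (h | h)
      · exact absurd (arcRel_le hA h) (not_le.2 hij)
      · exact h
    · exact fun h => Or.inr h
  have harc : ∀ i j, IsArc P i j ↔ arcRel m A i j := by
    intro i j
    rw [isArc_iff]
    constructor
    · rintro ⟨hij, h1, h2⟩
      rw [hP i j hij] at h1
      rcases h1.cases_head with rfl | ⟨k, hik, hkj⟩
      · exact absurd hij (lt_irrefl _)
      · have hik' : i < k := Fin.lt_def.2 (hA.bounds _ hik).2.1
        rcases (arcRel_le hA hkj).lt_or_eq with hlt | rfl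
        · exact absurd ((hP k j hlt).2 hkj) (h2 k hik' hlt)
        · exact hik
    · intro h
      have hij : i < j := Fin.lt_def.2 (hA.bounds _ h).2.1
      have hpart := (hP i j hij).2 (.single h)
      refine ⟨hij, hpart, fun k hik hkj heq => ?_⟩
      -- A chain from `i` to `k` must begin with the arc `(i, j)`, so it cannot end before `j`.
      rw [← hpart, eq_comm, hP i k hik] at heq
      rcases heq.cases_head with rfl | ⟨l, hil, hlk⟩
      · exact lt_irrefl _ hik
      · have : j = l := Fin.ext (congrArg Prod.snd (hA.left_unique _ h _ hil rfl))
        subst this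
        exact hkj.not_ge (arcRel_le hA hlk)
  refine ⟨P, fun i j k l h h' hc => ?_, ?_⟩
  · exact hA.noncrossing _ ((harc i k).1 h) _ ((harc j l).1 h') hc
  · ext p
    constructor
    · intro hp
      obtain ⟨i, j, rfl, h⟩ := exists_of_mem_partitionArcs hp
      exact (harc i j).1 h
    · intro hp
      have hb := hA.bounds p hp
      have h : IsArc P ⟨p.1, by omega⟩ ⟨p.2, hb.2.2⟩ := (harc _ _).2 hp
      exact mem_partitionArcs.2 h

theorem narayanaPolynomial_eval_neg_one (m : ℕ) :
    (narayanaPolynomial m).eval (-1) = interleavedCatalan (-1) m := by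
  classical
  have hle : ∀ P : Finpartition (univ : Finset (Fin m)), #P.parts ≤ m := fun P =>
    (Nat.le_add_left _ _).trans (card_partitionArcs_add_card_parts P).le
  have h1 : (narayanaPolynomial m).eval (-1) =
      ∑ P : Finpartition (univ : Finset (Fin m)) with IsNoncrossing P,
        (-1 : ℤ) ^ (m - #P.parts) := by
    rw [narayanaPolynomial, Polynomial.eval_finsetSum, ← Finset.sum_fiberwise_of_maps_to
      (t := range (m + 1)) (g := fun P => #P.parts)
      (fun P _ => mem_range.2 (Nat.lt_succ_of_le (hle P)))]
    refine Finset.sum_congr rfl fun k _ => ?_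
    rw [Finset.sum_congr rfl (g := fun _ => (-1 : ℤ) ^ (m - k)), Finset.sum_const,
      Finset.filter_filter, narayanaNumber, Nat.card_eq_fintype_card, Fintype.card_subtype]
    · simp
    · intro P hP
      rw [(mem_filter.1 hP).2]
  have h2 := sum_neg_one_pow_arcSets m 0
  rw [zero_add] at h2
  rw [h1, ← h2]
  refine Finset.sum_bij (fun P _ => partitionArcs P) ?_ ?_ ?_ ?_
  · intro P hP
    exact mem_arcSets.2 (isArcSet_partitionArcs (mem_filter.1 hP).2)
  · intro P _ P' _ h
    refine finpartition_eq_of_isArc fun i j => ?_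
    rw [← mem_partitionArcs, h, mem_partitionArcs]
  · intro A hA
    obtain ⟨P, hP, hPA⟩ := exists_partitionArcs_eq (mem_arcSets.1 hA)
    exact ⟨P, mem_filter.2 ⟨mem_univ _, hP⟩, hPA⟩
  · intro P _
    congr 1
    have := card_partitionArcs_add_card_parts P
    omega

end Narayana

/-! ### Comparison of the two sides -/

theorem one_sub_pow_mul_interleavedCatalan (q : ℤ) (n : ℕ) :
    (1 - q) ^ (n / 2) * interleavedCatalan (-1) (n + 1) =
      if Even n then (q - 1) ^ (n / 2) * (catalan (n / 2) : ℤ) else 0 := by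
  rcases Nat.even_or_odd' n with ⟨r, rfl | rfl⟩
  · rw [interleavedCatalan_odd, if_pos (by simp), ← mul_assoc,
      Nat.mul_div_cancel_left r two_pos, ← mul_pow]
    ring
  · rw [interleavedCatalan_even _ (by omega) (by simp [parity_simps]), mul_zero,
      if_neg (by simp)]

theorem interleavedCatalan_succ (y : ℤ) (n : ℕ) :
    interleavedCatalan y (n + 1) =
      if Even n then y ^ (n / 2) * (catalan (n / 2) : ℤ) else 0 := by
  rcases Nat.even_or_odd' n with ⟨r, rfl | rfl⟩
  · rw [interleavedCatalan_odd, if_pos (by simp), Nat.mul_div_cancel_left r two_pos]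
  · rw [interleavedCatalan_even _ (by omega) (by simp [parity_simps]), if_neg (by simp)]

theorem mainTheorem8 (n : ℕ) {F : Type*} [Field F] [Fintype F]
    (θ : AddChar F ℂ) (hθ : θ ≠ 1) :
    ((({χ : unitriangular (n + 1) F → ℂ |
          IsSupercharacter θ χ ∧ IsIrreducibleCharacter χ ∧ IsCInvariant χ}.ncard : ℕ) : ℤ)
        = (1 - (Fintype.card F : ℤ)) ^ (n / 2) * (narayanaPolynomial (n + 1)).eval (-1) ∧
      (1 - (Fintype.card F : ℤ)) ^ (n / 2) * (narayanaPolynomial (n + 1)).eval (-1)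
        = if Even n then ((Fintype.card F : ℤ) - 1) ^ (n / 2) * (catalan (n / 2) : ℤ) else 0) ∧
    ((({χ : unitriangular (n + 1) F → ℂ |
          IsSupercharacter θ χ ∧ IsHeisenbergCharacter χ ∧ IsCInvariant χ}.ncard : ℕ) : ℤ)
        = (1 - (Fintype.card F : ℤ)) ^ (n / 2) * (pellPolynomialSucc n).eval (-1) ∧
      (1 - (Fintype.card F : ℤ)) ^ (n / 2) * (pellPolynomialSucc n).eval (-1)
        = if Even n then ((Fintype.card F : ℤ) - 1) ^ (n / 2) else 0) := by
  have hcat : (1 - (Fintype.card F : ℤ)) ^ (n / 2) * (narayanaPolynomial (n + 1)).eval (-1)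
      = if Even n then ((Fintype.card F : ℤ) - 1) ^ (n / 2) * (catalan (n / 2) : ℤ) else 0 := by
    rw [narayanaPolynomial_eval_neg_one, one_sub_pow_mul_interleavedCatalan]
  have hpell : (1 - (Fintype.card F : ℤ)) ^ (n / 2) * (pellPolynomialSucc n).eval (-1)
      = if Even n then ((Fintype.card F : ℤ) - 1) ^ (n / 2) else 0 := by
    rw [pellPolynomialSucc_eval_neg_one, mul_ite, mul_zero, ← mul_pow]
    ring_nf
  refine ⟨⟨?_, hcat⟩, ?_, hpell⟩
  · rw [hcat, ncard_irreducible_supercharacters hθ, interleavedCatalan_succ]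
  · rw [hpell, ncard_heisenberg_supercharacters hθ]
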